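/- **Setup.** An *exponential factor* is a finite sum $q=\sum_k a_k z^{-k}$ with $k\in\mathbb Q_{>0}$, $a_k\in\mathbb C$; $E(q)$ is the set of $k$ with $a_k\neq0$, $\operatorname{ram}(q)\ge 1$ is the least common denominator of $E(q)$, $\operatorname{slope}(q)=\max E(q)$ (and $\operatorname{slope}(0)=0$), $\tau_k(q)=\sum_{l\ge k}a_lz^{-l}$. The Galois conjugates are $q^{(j)}=\sigma^j(q)=\sum_k a_k e^{2\pi\sqrt{-1}jk}z^{-k}$, and $\langle\pm q\rangle=\{\pm q^{(j)}\}_{j}$ is the Stokes-circle-up-to-sign of $q$ (*tame* if $q=0$). For $q\ne0$, $q$ is *special* if $|\langle\pm q\rangle|=\operatorname{ram}(q)$, and *nonspecial* otherwise. The *$BC$-level datum* is $$L_{BC}(q)=\Bigl(\{\operatorname{slope}(q)\}\cup\{\operatorname{slope}(q^{(i)}\pm q^{(j)}) : i\not\equiv j \bmod \operatorname{ram}(q)\}\Bigr)\setminus\{0\}.$$ The *common part* $q_c$ of $q$ and $\tilde q$, as seen in $q$, is the longest truncation of $q$, i.e. the sum of the terms of $q$ with exponent $k\in E(q)$ such that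 $\langle\pm\tau_k(q)\rangle=\langle\pm\tau_k(\tilde q)\rangle$; $\tilde q_c$ is defined likewise in $\tilde q$. The *fission exponent* is $f_{q,\tilde q}=\max\{\operatorname{slope}(q-q_c),\operatorname{slope}(\tilde q-\tilde q_c)\}$. All of these depend on the circles-up-to-sign only (the common part up to Galois conjugation and sign). **Type $BC$.** The group $W_{BC}(m)$ of signed permutations acts on $m$-tuples of exponential factors, and $W_D(m)$ is the subgroup with an even number of sign changes. A *full $BC$-irregular type* of rank $m\ge1$ is a tuple $Q=(q_1,\dots,q_m)$ (standing for $(q_1,\dots,q_m,-q_1,\dots,-q_m)$) with $\sigma(Q)=g(Q)$ for some $g\in W_{BC}(m)$ ("$g$ generates the Galois-orbit of $Q$"); a *$BC$-irregular class* is a $W_{BC}(m)$-orbit of such $Q$. Write $Q\sim_{BC}Q'$ if the ranks are equal, some $g\in W_{BC}(m)$ generates both Galois-orbits, $\operatorname{slope}(q_i\pm q_j)=\operatorname{slope}(q'_i\pm q'_j)$ for $i\ne j$, and $\operatorname{slope}(q_i)=\operatorname{slope}(q'_i)$ for all $i$. Two irregular classes are mutual $BC$-admissible deformations if they have representatives $Q\sim_{BC}Q'$.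 If $m_Q(q)$ is the number of occurrences of $q$ in $(q_1,\dots,q_m,-q_1,\dots,-q_m)$, the multiplicity $n$ of $\langle\pm q\rangle$ is $m_Q(q)/2$ if $q$ is special or $0$, and $m_Q(q)$ otherwise. A *pointed irregular type* is a list $\dot Q=((m_1,q_1),\dots,(m_p,q_p))$, $p\ge1$, with integers $m_i>0$ and pairwise distinct $\langle\pm q_i\rangle$. It is viewed as the full type that concatenates, for $i=1,\dots,p$, $m_i$ copies of each of $q_i^{(0)},\dots,q_i^{(r-1)}$, where $r=\operatorname{ram}(q_i)$, if $q_i$ is nonspecial or $0$, resp. of each of $q_i^{(0)},\dots,q_i^{(r/2-1)}$ if $q_i$ is special; put $n_i=m_i/2$ if $q_i$ is special, $n_i=m_i$ otherwise. It is *compatible* if for all $k>0$ and $i\ne j$, $\langle\pm\tau_k(q_i)\rangle=\langle\pm\tau_k(q_j)\rangle$ implies $\tau_k(q_i)=\tau_k(q_j)$. Its *labelled fission datum* consists of the list of pairs $(n_i,L_{BC}(q_i))$ and of the numbers $f_{ij}=f_{q_i,q_j}$ ($f_{ii}=0$). The *fission datum* of an irregular class is formed in the same way from its active circles-up-to-sign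 and their multiplicities, up to simultaneous permutation of the indices. **Type $D$.** An *enhanced pointed irregular type* is a pointed irregular type with signs $\varepsilon_1,\dots,\varepsilon_p\in\{\pm1\}$ such that $\varepsilon_i=(-1)^{m_i}$ if $q_i$ is special, $\varepsilon_i=1$ if $q_i$ is nonspecial ($\varepsilon_i$ is free if $q_i=0$), and $\prod_i\varepsilon_i=1$ (without the last condition: *quasi-irregular*). Two of them are mutual $D$-admissible deformations if they have the same $p$ and signs, the underlying full types have the same rank, some $g\in W_D(m)$ generates both Galois-orbits, and $\operatorname{slope}(q_a\pm q_b)=\operatorname{slope}(q'_a\pm q'_b)$ for all positions $a\ne b$ in these full types. An *enhanced pseudo-irregular class* is a linear combination $\sum_i m_i\cdot(\pm I_i,\varepsilon_i)$ of pairwise distinct circles-up-to-sign under the same conditions on signs; two of them are mutual $D$-admissible deformations if they are the classes $\sum_i m_i\cdot(\langle\pm q_i\rangle,\varepsilon_i)$ of two enhanced pointed quasi-irregular types that are. Let $\varnothing_D\neq\varnothing_{BC}$ be two symbols, and let $L_D(\mu,q)$ be: $\varnothing_D$ if $\mu=1$ and $q$ is $0$, or unramified, or special with $\operatorname{ram}(q)=2$;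 $\varnothing_{BC}$ if $q=0$, $\mu\ge2$; otherwise the set of nonzero slopes of $\tilde q_a\pm\tilde q_b$, $a\ne b$, where $(\tilde q_a)_a$ is the full type of $((\mu,q))$. The *labelled enhanced fission datum* consists of the list of the triples $(m_i,\mathbf L_i,\varepsilon_i)$ and of the $f_{ij}=f_{q_i,q_j}$, where $\mathbf L_i=L_D(m_i,q_i)$ if this is not $\varnothing_D$; otherwise $\mathbf L_i=\varnothing_D$ if $q_i$ has vanishing common part with all $q_j$, $j\ne i$, and $\mathbf L_i=L_{BC}(q_i)$ if not. The *enhanced fission datum* of an enhanced pseudo-irregular class is formed in the same way, up to simultaneous permutation of the indices. **Theorem.** 1. Two $BC$-irregular classes are mutual $BC$-admissible deformations if and only if they have the same fission datum. 2. Two compatible pointed irregular types are mutual $BC$-admissible deformations (i.e. their full types satisfy $\sim_{BC}$) if and only if they have the same labelled fission datum. 3. Two enhanced pseudo-irregular classes are mutual $D$-admissible deformations if and only if they have the same enhanced fission datum. 4. Two compatible enhanced pointed irregular types are mutual $D$-admissible deformations if and only if they have the same labelled enhanced fission datum. -/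

import Mathlib

namespace Fission

noncomputable section

/-! ### Exponential factors -/

/-- Positive rational numbers; the exponent `k` stands for the monomial `z ^ (-k)`. -/
abbrev Exponent : Type := {k : NNRat // 0 < k}

/-- An exponential factor: the principal part `∑ a_k z ^ (-k)` of a Puiseux series. -/
abbrev ExpFactor : Type := Exponent →₀ ℂ

/-- The `j`-th Galois conjugate `σ^j (q)`: the coefficient of `z ^ (-k)` is multiplied by
`exp (2 π i j k)`. -/
def galois (j : ℤ) (q : ExpFactor) : ExpFactor :=
  Finsupp.onFinset q.support
    (fun k => Complex.exp (2 * Real.pi * Complex.I * j * ((k.1 : ℚ) : ℂ)) * q k)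
    (fun _ h => Finsupp.mem_support_iff.mpr (right_ne_zero_of_mul h))

/-- The ramification: the least common denominator of the active exponents (`1` if `q = 0`). -/
def ram (q : ExpFactor) : ℕ := q.support.lcm fun k => k.1.den

/-- The slope: the largest active exponent (`0` if `q = 0`). -/
def slope (q : ExpFactor) : NNRat := q.support.sup fun k => k.1

/-- The truncation at height `k`: only the exponents `≥ k` are kept. -/
def trunc (k : NNRat) (q : ExpFactor) : ExpFactor := q.filter fun e => k ≤ e.1

/-- The Stokes-circle-up-to-sign `⟨± q⟩`: all Galois conjugates of `q` and their opposites. -/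
def circle (q : ExpFactor) : Set ExpFactor :=
  {x | ∃ j : ℤ, x = galois j q ∨ x = -galois j q}

/-- The set of all Stokes-circles-up-to-sign. -/
abbrev StokesCircle : Type := Set.range circle

/-- The Stokes-circle-up-to-sign of `q`, as an element of the set of all of them. -/
def mkCircle (q : ExpFactor) : StokesCircle := ⟨circle q, q, rfl⟩

/-- A representative of a Stokes-circle-up-to-sign. (The numerical data below do not depend on
which one is taken.) -/
def StokesCircle.rep (C : StokesCircle) : ExpFactor := C.2.choose

/-- `q ≠ 0` is special if `⟨± q⟩` has `ram q` elements; else it has `2 * ram q` of them. -/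
def IsSpecial (q : ExpFactor) : Prop := q ≠ 0 ∧ (circle q).ncard = ram q

/-! ### Level data and fission exponents -/

/-- The `BC`-level datum of an exponential factor: the slope of `q`, and the slopes of the sums and
differences of distinct Galois conjugates, without `0`. -/
def levelBC (q : ExpFactor) : Set NNRat :=
  ({slope q} ∪ {s | ∃ i j : ℤ, ¬ i ≡ j [ZMOD (ram q : ℤ)] ∧
    (s = slope (galois i q + galois j q) ∨ s = slope (galois i q - galois j q))}) \ {0}

open scoped Classical in
/-- The common part of `q` and `q'`, seen in `q`: the longest truncation of `q` for which the
truncations of `q` and `q'` lie in the same Stokes-circle-up-to-sign. -/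
def commonPart (q q' : ExpFactor) : ExpFactor :=
  q.filter fun k => circle (trunc k.1 q) = circle (trunc k.1 q')

/-- The fission exponent: the largest slope of the different parts. -/
def fissionExp (q q' : ExpFactor) : NNRat :=
  max (slope (q - commonPart q q')) (slope (q' - commonPart q' q))

/-! ### Signed permutations, full irregular types and their deformations -/

/-- Signed permutations of rank `m`, i.e. elements of the Weyl group of type `BC`: a permutation
and a tuple of signs. -/
structure SignedPerm (m : ℕ) where
  perm : Equiv.Perm (Fin m)
  sign : Fin m → ℤˣ

/-- The action on `m`-tuples of exponential factors. A tuple `Q = (q_1, …, q_m)` stands for the list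
`(q_1, …, q_m, -q_1, …, -q_m)`. -/
def SignedPerm.act {m : ℕ} (g : SignedPerm m) (Q : Fin m → ExpFactor) : Fin m → ExpFactor :=
  fun i => (g.sign i : ℤ) • Q (g.perm i)

/-- The elements of the Weyl group of type `D`: the number of sign-changes is even. -/
def SignedPerm.IsTypeD {m : ℕ} (g : SignedPerm m) : Prop := ∏ i, g.sign i = 1

/-- `g` generates the Galois-orbit of `Q`. -/
def SignedPerm.Generates {m : ℕ} (g : SignedPerm m) (Q : Fin m → ExpFactor) : Prop :=
  ∀ i, galois 1 (Q i) = g.act Q i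

/-- Mutual `BC`-admissible deformations of full irregular types. -/
def AdmissibleBC {m m' : ℕ} (Q : Fin m → ExpFactor) (Q' : Fin m' → ExpFactor) : Prop :=
  ∃ h : m = m',
    (∃ g : SignedPerm m, g.Generates Q ∧ g.Generates (fun i => Q' (Fin.cast h i))) ∧
    (∀ i j, i ≠ j →
      slope (Q i + Q j) = slope (Q' (Fin.cast h i) + Q' (Fin.cast h j)) ∧
      slope (Q i - Q j) = slope (Q' (Fin.cast h i) - Q' (Fin.cast h j))) ∧
    (∀ i, slope (Q i) = slope (Q' (Fin.cast h i)))

/-- Mutual `D`-admissible deformations of full (quasi-)irregular types. -/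
def AdmissibleD {m m' : ℕ} (Q : Fin m → ExpFactor) (Q' : Fin m' → ExpFactor) : Prop :=
  ∃ h : m = m',
    (∃ g : SignedPerm m, g.IsTypeD ∧ g.Generates Q ∧
      g.Generates (fun i => Q' (Fin.cast h i))) ∧
    (∀ i j, i ≠ j →
      slope (Q i + Q j) = slope (Q' (Fin.cast h i) + Q' (Fin.cast h j)) ∧
      slope (Q i - Q j) = slope (Q' (Fin.cast h i) - Q' (Fin.cast h j)))

/-- Full `BC`-irregular types of rank `m`: Galois-closed tuples. -/
def FullTypeBC (m : ℕ) : Type :=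
  {Q : Fin m → ExpFactor // ∃ g : SignedPerm m, g.Generates Q}

theorem sign_smul_smul (e : ℤˣ) (q : ExpFactor) : (e : ℤ) • (e : ℤ) • q = q := by
  rcases Int.units_eq_one_or e with rfl | rfl <;> simp

/-- `BC`-equivalence: two full irregular types are equivalent if they are in the same orbit of the
Weyl group of type `BC`. -/
instance bcSetoid (m : ℕ) : Setoid (FullTypeBC m) where
  r Q Q' := ∃ g : SignedPerm m, Q'.1 = g.act Q.1
  iseqv :=
    { refl := fun Q => ⟨⟨1, 1⟩, by funext i; simp [SignedPerm.act]⟩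
      symm := by
        rintro Q Q' ⟨g, h⟩
        refine ⟨⟨g.perm⁻¹, fun i => g.sign (g.perm⁻¹ i)⟩, ?_⟩
        funext i
        simp only [SignedPerm.act, h, sign_smul_smul]
        exact congrArg Q.1 (g.perm.apply_symm_apply i).symm
      trans := by
        rintro Q Q' Q'' ⟨g, h⟩ ⟨g', h'⟩
        refine ⟨⟨g'.perm.trans g.perm, fun i => g'.sign i * g.sign (g'.perm i)⟩, ?_⟩
        funext i
        simp [SignedPerm.act, h, h', mul_smul] }

/-- `BC`-irregular classes of rank `m`. -/
def ClassBC (m : ℕ) : Type := Quotient (bcSetoid m)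

/-- Mutual `BC`-admissible deformations of irregular classes. -/
def ClassBC.Admissible {m m' : ℕ} (Θ : ClassBC m) (Θ' : ClassBC m') : Prop :=
  ∃ (Q : FullTypeBC m) (Q' : FullTypeBC m'),
    Quotient.mk (bcSetoid m) Q = Θ ∧ Quotient.mk (bcSetoid m') Q' = Θ' ∧ AdmissibleBC Q.1 Q'.1

/-! ### Fission data -/

/-- A labelled fission datum: a list of `p` labels of type `α` (multiplicity and level datum), and
the fission exponents. -/
structure LabelledDatum (α : Type) where
  p : ℕ
  label : Fin p → α
  f : Fin p → Fin p → NNRat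

/-- Two labelled fission data agree up to a (simultaneous) relabelling. -/
instance datumSetoid (α : Type) : Setoid (LabelledDatum α) where
  r F F' := ∃ e : Fin F.p ≃ Fin F'.p,
    (∀ i, F'.label (e i) = F.label i) ∧ ∀ i j, F'.f (e i) (e j) = F.f i j
  iseqv :=
    { refl := fun F => ⟨Equiv.refl _, fun _ => rfl, fun _ _ => rfl⟩
      symm := by
        rintro F F' ⟨e, h1, h2⟩
        refine ⟨e.symm, fun i => ?_, fun i j => ?_⟩
        · rw [← h1, e.apply_symm_apply]
        · rw [← h2, e.apply_symm_apply, e.apply_symm_apply]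
      trans := by
        rintro F F' F'' ⟨e, h1, h2⟩ ⟨e', h1', h2'⟩
        refine ⟨e.trans e', fun i => ?_, fun i j => ?_⟩
        · simp [h1, h1']
        · simp [h2, h2'] }

/-- A fission datum: a labelled fission datum without the ordering of the labels. -/
def Datum (α : Type) : Type := Quotient (datumSetoid α)

/-- Forget the labelling. -/
def LabelledDatum.forget {α : Type} (F : LabelledDatum α) : Datum α :=
  Quotient.mk (datumSetoid α) F

/-- Labels in type `BC`: a multiplicity in `½ ℤ` and a `BC`-level datum. -/
abbrev LabelBC : Type := ℚ × Set NNRat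

/-- The labelled `BC`-fission datum of a list of pairs `(n_i, q_i)`. -/
def datumBC {p : ℕ} (n : Fin p → ℚ) (q : Fin p → ExpFactor) : LabelledDatum LabelBC where
  p := p
  label i := (n i, levelBC (q i))
  f i j := fissionExp (q i) (q j)

open scoped Classical in
/-- The active Stokes-circles-up-to-sign of `Q`. -/
def activeCircles {m : ℕ} (Q : Fin m → ExpFactor) : Finset StokesCircle :=
  Finset.univ.image fun i => mkCircle (Q i)

open scoped Classical in
/-- The number of occurrences of `q` in the list `(q_1, …, q_m, -q_1, …, -q_m)`. -/
def occurrences {m : ℕ} (Q : Fin m → ExpFactor) (q : ExpFactor) : ℕ :=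
  ∑ i, ((if Q i = q then 1 else 0) + (if -Q i = q then 1 else 0))

open scoped Classical in
/-- The multiplicity `n_Q` of the Stokes-circle-up-to-sign of `q` in `Q`, so that the irregular
class of `Q` is the linear combination `∑ n_Q(± I) · (± I)`. -/
def multBC {m : ℕ} (Q : Fin m → ExpFactor) (q : ExpFactor) : ℚ :=
  if q = 0 ∨ IsSpecial q then (occurrences Q q : ℚ) / 2 else occurrences Q q

/-- The fission datum of a linear combination of Stokes-circles-up-to-sign. -/
def datumOfCircles (A : Finset StokesCircle) (n : ExpFactor → ℚ) : Datum LabelBC :=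
  (datumBC (fun i : Fin A.card => n (A.equivFin.symm i).1.rep)
    (fun i : Fin A.card => (A.equivFin.symm i).1.rep)).forget

theorem circle_neg (q : ExpFactor) : circle (-q) = circle q := by
  have h : ∀ j : ℤ, galois j (-q) = -galois j q := by
    intro j; ext k; simp [galois]
  ext x
  simp only [circle, Set.mem_ofPred_eq, h, neg_neg]
  exact exists_congr fun j => or_comm

theorem mkCircle_sign_smul (e : ℤˣ) (q : ExpFactor) : mkCircle ((e : ℤ) • q) = mkCircle q := by
  rcases Int.units_eq_one_or e with rfl | rfl
  · simp
  · apply Subtype.ext; simp [mkCircle, circle_neg]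

theorem activeCircles_act {m : ℕ} (g : SignedPerm m) (Q : Fin m → ExpFactor) :
    activeCircles (g.act Q) = activeCircles Q := by
  classical
  ext C
  simp only [activeCircles, Finset.mem_image, Finset.mem_univ, true_and, SignedPerm.act,
    mkCircle_sign_smul]
  constructor
  · rintro ⟨i, hi⟩; exact ⟨_, hi⟩
  · rintro ⟨i, hi⟩; exact ⟨g.perm⁻¹ i, by simpa using hi⟩

theorem occurrences_act {m : ℕ} (g : SignedPerm m) (Q : Fin m → ExpFactor) :
    occurrences (g.act Q) = occurrences Q := by
  classical
  funext q
  unfold occurrences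
  refine Fintype.sum_equiv g.perm _ _ fun i => ?_
  rcases Int.units_eq_one_or (g.sign i) with h | h <;> simp [SignedPerm.act, h, add_comm]

/-- The `BC`-fission datum of an irregular class. -/
def ClassBC.fissionDatum {m : ℕ} (Θ : ClassBC m) : Datum LabelBC :=
  Quotient.lift (fun Q : FullTypeBC m => datumOfCircles (activeCircles Q.1) (multBC Q.1))
    (by
      rintro Q Q' ⟨g, h⟩
      have h2 : multBC Q'.1 = multBC Q.1 := by
        funext q; simp only [multBC, h, occurrences_act]
      have h1 : activeCircles Q'.1 = activeCircles Q.1 := by rw [h, activeCircles_act]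
      simp only [h1, h2]) Θ

/-! ### Pointed irregular types -/

/-- Pointed irregular types `((m_1, q_1), …, (m_p, q_p))`, with integer multiplicities. -/
structure PointedType where
  p : ℕ
  p_pos : 0 < p
  mult : Fin p → ℕ
  mult_pos : ∀ i, 0 < mult i
  q : Fin p → ExpFactor
  distinct : ∀ i j, i ≠ j → circle (q i) ≠ circle (q j)

open scoped Classical in
/-- The sublist of the full irregular type contributed by a pair `(μ, q)`: `μ` copies of each of
the conjugates `q^(0), …, q^(r-1)`, or only of `q^(0), …, q^(r/2-1)` if `q` is special. -/
def circleList (μ : ℕ) (q : ExpFactor) : List ExpFactor :=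
  (List.range (if IsSpecial q then ram q / 2 else ram q)).flatMap
    fun a => List.replicate μ (galois (a : ℤ) q)

namespace PointedType

/-- The full irregular type underlying a pointed one, as a list. -/
def fullList (P : PointedType) : List ExpFactor :=
  (List.finRange P.p).flatMap fun i => circleList (P.mult i) (P.q i)

/-- The full irregular type underlying a pointed one. -/
def full (P : PointedType) : Fin P.fullList.length → ExpFactor := P.fullList.get

/-- Compatibility of the chosen representatives. -/
def Compatible (P : PointedType) : Prop :=
  ∀ k : NNRat, 0 < k → ∀ i j, i ≠ j →
    circle (trunc k (P.q i)) = circle (trunc k (P.q j)) → trunc k (P.q i) = trunc k (P.q j)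

open scoped Classical in
/-- The multiplicities `n_i`: half of `m_i` if `q_i` is special, and `m_i` otherwise. In this way
the rank is `∑ n_i * ram (q_i)`. -/
def halfMult (P : PointedType) (i : Fin P.p) : ℚ :=
  if IsSpecial (P.q i) then (P.mult i : ℚ) / 2 else P.mult i

/-- The labelled `BC`-fission datum of a pointed irregular type. -/
def labelledDatumBC (P : PointedType) : LabelledDatum LabelBC := datumBC P.halfMult P.q

end PointedType

/-! ### Type `D` -/

/-- `D`-level data: the two kinds of empty level data, or a set of levels. -/
inductive LevelD : Type
  | emptyD
  | emptyBC
  | levels (L : Set NNRat)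

/-- The naive `D`-level datum of the elementary pointed quasi-irregular type `(μ, q)`. -/
def naiveLevelD (μ : ℕ) (q : ExpFactor) : Set NNRat :=
  {s | ∃ i j : Fin (circleList μ q).length, i ≠ j ∧
    (s = slope ((circleList μ q).get i + (circleList μ q).get j) ∨
      s = slope ((circleList μ q).get i - (circleList μ q).get j))} \ {0}

open scoped Classical in
/-- The `D`-level datum of the elementary pointed quasi-irregular type `(μ, q)`. -/
def levelD (μ : ℕ) (q : ExpFactor) : LevelD :=
  if μ = 1 ∧ (q = 0 ∨ ram q = 1 ∨ (IsSpecial q ∧ ram q = 2)) then LevelD.emptyD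
  else if q = 0 then LevelD.emptyBC
  else LevelD.levels (naiveLevelD μ q)

open scoped Classical in
/-- The `D`-level datum of the `i`-th active circle inside the list of pairs `(m_i, q_i)`. -/
def levelDIn {p : ℕ} (m : Fin p → ℕ) (q : Fin p → ExpFactor) (i : Fin p) : LevelD :=
  if levelD (m i) (q i) ≠ LevelD.emptyD then levelD (m i) (q i)
  else if ∀ j, j ≠ i → commonPart (q i) (q j) = 0 then LevelD.emptyD
  else LevelD.levels (levelBC (q i))

/-- Labels in type `D`: an integer multiplicity and an enhanced `D`-level datum. -/
abbrev LabelD : Type := ℕ × (LevelD × ℤˣ)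

/-- The labelled enhanced `D`-fission datum of a list of triples `(m_i, q_i, ε_i)`. -/
def datumD {p : ℕ} (m : Fin p → ℕ) (q : Fin p → ExpFactor) (ε : Fin p → ℤˣ) :
    LabelledDatum LabelD where
  p := p
  label i := (m i, (levelDIn m q i, ε i))
  f i j := fissionExp (q i) (q j)

/-- Enhanced pointed quasi-irregular types: the sign of a tame circle is not constrained. -/
structure EnhancedPointedType extends PointedType where
  sign : Fin p → ℤˣ
  sign_special : ∀ i, IsSpecial (q i) → sign i = (-1) ^ mult i
  sign_nonspecial : ∀ i, q i ≠ 0 → ¬ IsSpecial (q i) → sign i = 1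

namespace EnhancedPointedType

/-- An enhanced pointed irregular type is one with global sign `1`. -/
def IsIrregularType (P : EnhancedPointedType) : Prop := ∏ i, P.sign i = 1

/-- Mutual `D`-admissible deformations of enhanced pointed quasi-irregular types. -/
def Admissible (P P' : EnhancedPointedType) : Prop :=
  (∃ h : P.p = P'.p, ∀ i, P.sign i = P'.sign (Fin.cast h i)) ∧
    AdmissibleD P.toPointedType.full P'.toPointedType.full

/-- The labelled enhanced `D`-fission datum. -/
def labelledDatum (P : EnhancedPointedType) : LabelledDatum LabelD := datumD P.mult P.q P.sign

open scoped Classical in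
/-- The terms of the linear combination `∑ m_i · (⟨± q_i⟩, ε_i)`. -/
def classTerms (P : EnhancedPointedType) : Finset (StokesCircle × ℕ × ℤˣ) :=
  Finset.univ.image fun i => (mkCircle (P.q i), P.mult i, P.sign i)

end EnhancedPointedType

/-- Enhanced quasi-irregular classes: linear combinations `∑ m_i · (± I_i, ε_i)` of
pairwise-distinct Stokes-circles-up-to-sign, given by the set of the triples `(± I_i, m_i, ε_i)`. -/
structure EnhancedClass where
  terms : Finset (StokesCircle × ℕ × ℤˣ)
  nonempty : terms.Nonempty
  distinct : ∀ s ∈ terms, ∀ t ∈ terms, s.1 = t.1 → s = t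
  mult_pos : ∀ t ∈ terms, 0 < t.2.1
  sign_special : ∀ t ∈ terms, IsSpecial t.1.rep → t.2.2 = (-1) ^ t.2.1
  sign_nonspecial : ∀ t ∈ terms, t.1.rep ≠ 0 → ¬ IsSpecial t.1.rep → t.2.2 = 1

namespace EnhancedClass

/-- An enhanced pseudo-irregular class is one with global sign `1`. -/
def IsPseudoIrregularClass (Θ : EnhancedClass) : Prop := ∏ t ∈ Θ.terms, t.2.2 = 1

/-- Mutual `D`-admissible deformations of enhanced quasi-irregular classes. -/
def Admissible (Θ Θ' : EnhancedClass) : Prop :=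
  ∃ P P' : EnhancedPointedType,
    P.classTerms = Θ.terms ∧ P'.classTerms = Θ'.terms ∧ P.Admissible P'

/-- The enhanced `D`-fission datum. -/
def fissionDatum (Θ : EnhancedClass) : Datum LabelD :=
  (datumD (fun i : Fin Θ.terms.card => (Θ.terms.equivFin.symm i).1.2.1)
    (fun i : Fin Θ.terms.card => (Θ.terms.equivFin.symm i).1.1.rep)
    (fun i : Fin Θ.terms.card => (Θ.terms.equivFin.symm i).1.2.2)).forget

end EnhancedClass

end

end Fission

/-!
The circle `⟨± q⟩` is the orbit of `q` under the twists `q ↦ ± σ^j (q)`, and the slope is an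
ultrametric norm for which the twists are isometries. In these terms all fission data are
distances:

* `levelBC q` consists of the nonzero distances from `q` to the points of its own circle, and
  knowing this set is the same as knowing the distance from `q` to each of its twists, one by one
  (`levelBC_eq_iff`): a distance which is a level is an active exponent of every exponential factor
  with the same levels, and whether a twist moves the coefficient at an exponent depends on the
  exponent only. In particular the level datum knows whether `q` is special, and the period of `q`
  up to sign, which is the number of conjugates listed for it in a full type
  (`exists_galois_eq_smul_iff`).
* `fissionExp q q'` is the smallest distance between the two circles (`fissionExp_le_iff`), and a
  pointed type is compatible if and only if its points realize all these distances
  (`compatible_iff`). By the strong triangle inequality all distances between the circles of such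
  points are then determined by level data and fission exponents
  (`slope_twist_sub_of_compatible`).
* In type `D`, where slopes of sums and differences at distinct positions are compared, the slope of
  `q` itself is invisible only if its circle occupies a single position and `q` has no common part
  with the other circles; the enhanced level datum is the `BC`-level datum as soon as the slope is
  visible and `q ≠ 0` (`levelDIn_eq`).

If two full types are admissible deformations of each other, then a common generator of their
Galois-orbits carries twists to positions in the same way for both, so that the partition of the
positions into circles, the multiplicities, the fission exponents and the level data agree
(`Agree`, `AdmissibleBC.datumBC_eq`, `AdmissibleD.datumD_eq`). This direction does not use
compatibility. Since the blocks of a full type are consecutive, even the labelling is determined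
(`Blocks.unique`).

Conversely, if compatible pointed types have the same data, then their full types are listed by the
same set of places, their mutual slopes agree, and moving each conjugate to the next one is a common
generator (`exists_generator`). In type `D` the product of its signs over the places of a circle is
the sign `ε i` of this circle, where the free sign of a tame circle is used; this is why the
condition `∏ i, ε i = 1` puts it in the Weyl group of type `D`.

Finally every finite set of circles has compatible representatives (`exists_compatible`), and the
data depend on circles only; so the statements on classes follow from those on pointed types.
-/

namespace Fission

noncomputable section

/-! ### Slopes as an ultrametric norm -/

theorem slope_le_iff {q : ExpFactor} {s : NNRat} :
    slope q ≤ s ↔ ∀ k : Exponent, s < k.1 → q k = 0 := by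
  simp only [slope, Finset.sup_le_iff, Finsupp.mem_support_iff]
  exact forall_congr' fun k => ⟨fun h hk => by_contra fun h0 => absurd (h h0) (not_le.2 hk),
    fun h h0 => not_lt.1 fun hk => h0 (h hk)⟩

theorem le_slope {q : ExpFactor} {k : Exponent} (h : q k ≠ 0) : k.1 ≤ slope q :=
  not_lt.1 fun hk => h (slope_le_iff.1 le_rfl k hk)

theorem exists_slope_eq {q : ExpFactor} (h : slope q ≠ 0) :
    ∃ k : Exponent, k.1 = slope q ∧ q k ≠ 0 := by
  have hne : q.support.Nonempty := by
    rw [Finset.nonempty_iff_ne_empty]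
    intro h0
    exact h (by simp [slope, h0])
  obtain ⟨k, hk, hk'⟩ := Finset.exists_mem_eq_sup _ hne (fun k : Exponent => k.1)
  exact ⟨k, hk'.symm, Finsupp.mem_support_iff.1 hk⟩

@[simp] theorem slope_zero : slope 0 = 0 := by simp [slope]

theorem slope_eq_zero_iff {q : ExpFactor} : slope q = 0 ↔ q = 0 := by
  refine ⟨fun h => ?_, fun h => by simp [h]⟩
  ext k
  exact slope_le_iff.1 h.le k k.2

@[simp] theorem slope_neg (q : ExpFactor) : slope (-q) = slope q := by
  simp [slope, Finsupp.support_neg]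

theorem slope_sub_comm (q q' : ExpFactor) : slope (q - q') = slope (q' - q) := by
  rw [← slope_neg, neg_sub]

theorem slope_add_le (q q' : ExpFactor) : slope (q + q') ≤ max (slope q) (slope q') := by
  rw [slope_le_iff]
  intro k hk
  rw [max_lt_iff] at hk
  simp [slope_le_iff.1 le_rfl k hk.1, slope_le_iff.1 le_rfl k hk.2]

theorem slope_sub_le (q q' : ExpFactor) : slope (q - q') ≤ max (slope q) (slope q') := by
  simpa [sub_eq_add_neg] using slope_add_le q (-q')

/-- The strong triangle inequality. -/
theorem slope_sub_le_max (a b c : ExpFactor) :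
    slope (a - c) ≤ max (slope (a - b)) (slope (b - c)) := by
  simpa using slope_add_le (a - b) (b - c)

theorem slope_two_nsmul (q : ExpFactor) : slope (q + q) = slope q := by
  have : (q + q).support = q.support := by
    ext k; simp [← two_mul]
  simp [slope, this]

theorem max_slope_add_sub (q q' : ExpFactor) :
    max (slope (q + q')) (slope (q - q')) = max (slope q) (slope q') := by
  refine le_antisymm (max_le (slope_add_le _ _) (slope_sub_le _ _)) (max_le ?_ ?_)
  · have := slope_add_le (q + q') (q - q')
    rwa [show q + q' + (q - q') = q + q by abel, slope_two_nsmul] at this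
  · have := slope_sub_le (q + q') (q - q')
    rwa [show q + q' - (q - q') = q' + q' by abel, slope_two_nsmul] at this

/-! ### Twists: Galois conjugation combined with a sign -/

@[simp] theorem galois_apply (j : ℤ) (q : ExpFactor) (k : Exponent) :
    galois j q k = Complex.exp (2 * Real.pi * Complex.I * j * ((k.1 : ℚ) : ℂ)) * q k := rfl

/-- The Galois conjugate `σ^j (q)` up to a sign `e`. The group `ℤˣ × ℤ` acts in this way by
isometries for the slope, and `circle q` is the orbit of `q`. -/
def twist (e : ℤˣ) (j : ℤ) (q : ExpFactor) : ExpFactor := (e : ℤ) • galois j q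

theorem twist_apply (e : ℤˣ) (j : ℤ) (q : ExpFactor) (k : Exponent) :
    twist e j q k =
      ((e : ℤ) : ℂ) * Complex.exp (2 * Real.pi * Complex.I * j * ((k.1 : ℚ) : ℂ)) * q k := by
  simp [twist, mul_assoc]

theorem twist_twist (e e' : ℤˣ) (i j : ℤ) (q : ExpFactor) :
    twist e i (twist e' j q) = twist (e * e') (i + j) q := by
  ext k
  simp only [twist_apply, Int.cast_add, Units.val_mul, Int.cast_mul, mul_add, add_mul,
    Complex.exp_add]
  ring

@[simp] theorem twist_one_zero (q : ExpFactor) : twist 1 0 q = q := by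
  ext k; simp [twist_apply]

theorem twist_zero_right (e : ℤˣ) (q : ExpFactor) : twist e 0 q = (e : ℤ) • q := by
  ext k; simp [twist_apply]

theorem twist_one_left (j : ℤ) (q : ExpFactor) : twist 1 j q = galois j q := by
  simp [twist]

@[simp] theorem twist_zero (e : ℤˣ) (j : ℤ) : twist e j 0 = 0 := by
  ext k; simp [twist_apply]

theorem twist_sub (e : ℤˣ) (j : ℤ) (q q' : ExpFactor) :
    twist e j (q - q') = twist e j q - twist e j q' := by
  ext k; simp [twist_apply]; ring

theorem twist_apply_ne_zero {e : ℤˣ} {j : ℤ} {q : ExpFactor} {k : Exponent} :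
    twist e j q k ≠ 0 ↔ q k ≠ 0 := by
  have : ((e : ℤ) : ℂ) ≠ 0 := by exact_mod_cast e.ne_zero
  simp [twist_apply, Complex.exp_ne_zero]

@[simp] theorem slope_twist (e : ℤˣ) (j : ℤ) (q : ExpFactor) : slope (twist e j q) = slope q := by
  have : (twist e j q).support = q.support := by
    ext k
    rw [Finsupp.mem_support_iff, Finsupp.mem_support_iff, twist_apply_ne_zero]
  simp [slope, this]

@[simp] theorem slope_unit_smul (e : ℤˣ) (q : ExpFactor) : slope ((e : ℤ) • q) = slope q := by
  rw [← twist_zero_right, slope_twist]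

/-- Twisting the second argument is twisting the first one by the inverse. -/
theorem slope_sub_twist (e : ℤˣ) (j : ℤ) (q q' : ExpFactor) :
    slope (q - twist e j q') = slope (twist e (-j) q - q') := by
  rw [← slope_twist e (-j), twist_sub, twist_twist]
  simp

theorem slope_twist_sub_twist (e e' : ℤˣ) (i j : ℤ) (q q' : ExpFactor) :
    slope (twist e i q - twist e' j q') = slope (twist (e * e') (i - j) q - q') := by
  rw [slope_sub_twist, twist_twist, mul_comm e', neg_add_eq_sub]

theorem mem_circle_iff {q x : ExpFactor} : x ∈ circle q ↔ ∃ e j, x = twist e j q := by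
  constructor
  · rintro ⟨j, rfl | rfl⟩
    · exact ⟨1, j, by simp [twist]⟩
    · exact ⟨-1, j, by simp [twist]⟩
  · rintro ⟨e, j, rfl⟩
    refine ⟨j, ?_⟩
    rcases Int.units_eq_one_or e with rfl | rfl <;> simp [twist]

theorem self_mem_circle (q : ExpFactor) : q ∈ circle q := mem_circle_iff.2 ⟨1, 0, by simp⟩

@[simp] theorem circle_twist (e : ℤˣ) (j : ℤ) (q : ExpFactor) :
    circle (twist e j q) = circle q := by
  ext x
  rw [mem_circle_iff, mem_circle_iff]
  constructor
  · rintro ⟨e', i, rfl⟩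
    exact ⟨_, _, twist_twist _ _ _ _ _⟩
  · rintro ⟨e', i, rfl⟩
    exact ⟨e' * e, i - j, by simp [twist_twist, mul_assoc]⟩

theorem circle_eq_iff {q q' : ExpFactor} : circle q = circle q' ↔ ∃ e j, q = twist e j q' := by
  constructor
  · intro h
    exact mem_circle_iff.1 (h ▸ self_mem_circle q)
  · rintro ⟨e, j, rfl⟩
    simp

theorem circle_eq_iff' {q q' : ExpFactor} : circle q = circle q' ↔ ∃ e j, twist e j q = q' := by
  rw [eq_comm, circle_eq_iff]
  simp only [eq_comm]

theorem slope_congr {q q' : ExpFactor} (h : circle q = circle q') : slope q = slope q' := by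
  obtain ⟨e, j, rfl⟩ := circle_eq_iff.1 h
  simp

theorem circle_rep (C : StokesCircle) : circle C.rep = C.1 := C.2.choose_spec

theorem circle_mkCircle_rep (q : ExpFactor) : circle (mkCircle q).rep = circle q :=
  circle_rep (mkCircle q)

theorem mkCircle_rep (C : StokesCircle) : mkCircle C.rep = C := Subtype.ext (circle_rep C)

theorem mkCircle_eq_iff {q q' : ExpFactor} : mkCircle q = mkCircle q' ↔ circle q = circle q' :=
  Subtype.ext_iff

/-! ### Level data -/

theorem galois_eq_smul_iff {e : ℤˣ} {j : ℤ} {q : ExpFactor} :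
    galois j q = (e : ℤ) • q ↔ slope (twist e j q - q) = 0 := by
  rw [slope_eq_zero_iff, sub_eq_zero]
  rcases Int.units_eq_one_or e with rfl | rfl <;> simp [twist, neg_eq_iff_eq_neg]

theorem twist_neg_one_zero_slope (q : ExpFactor) : slope (twist (-1) 0 q - q) = slope q := by
  rw [← slope_two_nsmul q, ← slope_neg, twist_zero_right]
  congr 1
  simp

theorem exp_two_pi_eq_one_iff {j : ℤ} {k : Exponent} :
    Complex.exp (2 * Real.pi * Complex.I * j * ((k.1 : ℚ) : ℂ)) = 1 ↔ (k.1.den : ℤ) ∣ j := by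
  have hd : (k.1.den : ℚ) ≠ 0 := by exact_mod_cast k.1.den_ne_zero
  have hq : (k.1 : ℚ) * k.1.den = k.1.num := by exact_mod_cast NNRat.mul_den_eq_num k.1
  have hco : IsCoprime (k.1.den : ℤ) (k.1.num : ℤ) :=
    Nat.isCoprime_iff_coprime.2 (NNRat.coprime_num_den k.1).symm
  rw [Complex.exp_eq_one_iff]
  have h1 : (∃ n : ℤ, 2 * (Real.pi : ℂ) * Complex.I * j * ((k.1 : ℚ) : ℂ)
      = n * (2 * Real.pi * Complex.I)) ↔ ∃ n : ℤ, (j : ℚ) * (k.1 : ℚ) = n := by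
    refine exists_congr fun n => ?_
    have h0 : (2 * (Real.pi : ℂ) * Complex.I) ≠ 0 := Complex.two_pi_I_ne_zero
    rw [mul_comm (n : ℂ), mul_assoc, mul_right_inj' h0]
    exact_mod_cast Iff.rfl
  rw [h1]
  constructor
  · rintro ⟨n, hn⟩
    refine hco.dvd_of_dvd_mul_right ⟨n, ?_⟩
    have : (j : ℚ) * k.1.num = k.1.den * n := by rw [← hq, ← hn]; ring
    exact_mod_cast this
  · rintro ⟨n, rfl⟩
    refine ⟨n * k.1.num, ?_⟩
    push_cast
    rw [← hq]; ring

theorem galois_eq_self_iff {j : ℤ} {q : ExpFactor} : galois j q = q ↔ (ram q : ℤ) ∣ j := by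
  have h1 : (ram q : ℤ) ∣ j ↔ ∀ k ∈ q.support, k.1.den ∣ j.natAbs := by
    rw [← Int.dvd_natAbs, Int.natCast_dvd_natCast, ram, Finset.lcm_dvd_iff]
  rw [h1]
  constructor
  · intro h k hk
    have := DFunLike.congr_fun h k
    rw [galois_apply, mul_eq_right₀ (Finsupp.mem_support_iff.1 hk), exp_two_pi_eq_one_iff] at this
    rwa [← Int.natCast_dvd_natCast, Int.dvd_natAbs]
  · intro h
    ext k
    by_cases hk : q k = 0
    · simp [hk]
    · have := h k (Finsupp.mem_support_iff.2 hk)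
      rw [← Int.natCast_dvd_natCast, Int.dvd_natAbs, ← exp_two_pi_eq_one_iff] at this
      rw [galois_apply, this, one_mul]

theorem ram_pos (q : ExpFactor) : 0 < ram q := by
  refine Nat.pos_of_ne_zero fun h => ?_
  rw [ram, Finset.lcm_eq_zero_iff] at h
  obtain ⟨k, _, hk⟩ := h
  exact k.1.den_ne_zero hk

theorem galois_eq_galois_iff {i j : ℤ} {q : ExpFactor} :
    galois i q = galois j q ↔ (ram q : ℤ) ∣ i - j := by
  rw [← galois_eq_self_iff, ← twist_one_left, ← twist_one_left, ← twist_one_left,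
    ← sub_eq_zero, ← slope_eq_zero_iff, slope_twist_sub_twist, slope_eq_zero_iff, sub_eq_zero,
    mul_one]

/-- The `BC`-level datum consists of the nonzero distances of `q` to its own circle. -/
theorem mem_levelBC_iff {q : ExpFactor} {s : NNRat} :
    s ∈ levelBC q ↔ s ≠ 0 ∧ ∃ e j, s = slope (twist e j q - q) := by
  have hadd : ∀ i j, slope (galois i q + galois j q) = slope (twist (-1) (i - j) q - q) := by
    intro i j
    rw [← one_mul (-1 : ℤˣ), ← slope_twist_sub_twist]
    simp [twist]
  have hsub : ∀ i j, slope (galois i q - galois j q) = slope (twist 1 (i - j) q - q) := by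
    intro i j
    rw [← one_mul (1 : ℤˣ), ← slope_twist_sub_twist]
    simp [twist]
  constructor
  · rintro ⟨rfl | ⟨i, j, -, rfl | rfl⟩, h0⟩
    · exact ⟨h0, -1, 0, (twist_neg_one_zero_slope q).symm⟩
    · exact ⟨h0, -1, i - j, hadd i j⟩
    · exact ⟨h0, 1, i - j, hsub i j⟩
  · rintro ⟨h0, e, j, rfl⟩
    refine ⟨?_, h0⟩
    by_cases hj : (ram q : ℤ) ∣ j
    · -- here `σ^j (q) = q`, so the distance is `slope q` or `0`
      left
      rcases Int.units_eq_one_or e with rfl | rfl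
      · refine absurd ?_ h0
        rw [← galois_eq_smul_iff, galois_eq_self_iff.2 hj]; simp
      · rw [Set.mem_singleton_iff, ← twist_neg_one_zero_slope q, twist, galois_eq_self_iff.2 hj,
          twist_zero_right]
    · right
      refine ⟨j, 0, fun h => hj ?_, ?_⟩
      · simpa using h.symm.dvd
      · rw [hadd, hsub, sub_zero]
        rcases Int.units_eq_one_or e with rfl | rfl
        · exact Or.inr rfl
        · exact Or.inl rfl

theorem slope_twist_sub_le_of_levelBC_eq {q q' : ExpFactor} (h : levelBC q = levelBC q')
    (e : ℤˣ) (j : ℤ) : slope (twist e j q - q) ≤ slope (twist e j q' - q') := by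
  by_cases h0 : slope (twist e j q - q) = 0
  · simp [h0]
  -- the distance `s` is a level, hence an active exponent of `q'`, and whether `(e, j)` moves
  -- the coefficient at `s` depends on `s` only
  obtain ⟨-, e', j', hs⟩ := mem_levelBC_iff.1 (h ▸ mem_levelBC_iff.2 ⟨h0, e, j, rfl⟩)
  obtain ⟨k, hk, hk0⟩ := exists_slope_eq h0
  obtain ⟨k', hk', hk0'⟩ := exists_slope_eq (hs ▸ h0)
  obtain rfl : k = k' := Subtype.ext (hk.trans (hs.trans hk'.symm))
  rw [← hk]
  refine le_slope ?_
  rw [Finsupp.sub_apply, twist_apply, ← sub_one_mul] at hk0 hk0' ⊢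
  exact mul_ne_zero (left_ne_zero_of_mul hk0) (right_ne_zero_of_mul hk0')

/-- Equality of `BC`-level data means that `q` and `q'` are moved equally far by every twist. -/
theorem levelBC_eq_iff {q q' : ExpFactor} :
    levelBC q = levelBC q' ↔ ∀ e j, slope (twist e j q - q) = slope (twist e j q' - q') := by
  constructor
  · exact fun h e j => le_antisymm (slope_twist_sub_le_of_levelBC_eq h e j)
      (slope_twist_sub_le_of_levelBC_eq h.symm e j)
  · intro h
    ext s
    simp only [mem_levelBC_iff, h]

theorem slope_eq_of_levelBC_eq {q q' : ExpFactor} (h : levelBC q = levelBC q') :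
    slope q = slope q' := by
  rw [← twist_neg_one_zero_slope, levelBC_eq_iff.1 h, twist_neg_one_zero_slope]

theorem levelBC_congr {q q' : ExpFactor} (h : circle q = circle q') : levelBC q = levelBC q' := by
  obtain ⟨e, j, rfl⟩ := circle_eq_iff.1 h
  rw [levelBC_eq_iff]
  intro e' j'
  rw [twist_twist, slope_twist_sub_twist]
  congr 3
  · rcases Int.units_eq_one_or e with rfl | rfl <;> simp
  · ring

theorem galois_eq_smul_congr {q q' : ExpFactor} (h : levelBC q = levelBC q') (e : ℤˣ) (j : ℤ) :
    galois j q = (e : ℤ) • q ↔ galois j q' = (e : ℤ) • q' := by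
  rw [galois_eq_smul_iff, galois_eq_smul_iff, levelBC_eq_iff.1 h]

theorem eq_zero_congr {q q' : ExpFactor} (h : levelBC q = levelBC q') : q = 0 ↔ q' = 0 := by
  rw [← slope_eq_zero_iff, ← slope_eq_zero_iff, slope_eq_of_levelBC_eq h]

/-! ### Special exponential factors and the number of sheets -/

theorem neg_ne_self {q : ExpFactor} (h : q ≠ 0) : -q ≠ q := by
  intro h'
  exact h (by rwa [neg_eq_self] at h')

theorem ncard_range_galois (q : ExpFactor) : (Set.range fun j : ℤ => galois j q).ncard = ram q := by
  have : (Set.range fun j : ℤ => galois j q) = (fun j : ℕ => galois j q) '' Set.Iio (ram q) := by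
    ext x
    constructor
    · rintro ⟨j, rfl⟩
      have h0 : (0 : ℤ) < ram q := by exact_mod_cast ram_pos q
      refine ⟨(j % ram q).toNat, ?_, ?_⟩
      · have := Int.emod_lt_of_pos j h0
        have := Int.emod_nonneg j h0.ne'
        simp only [Set.mem_Iio]; omega
      · simp only [galois_eq_galois_iff, Int.toNat_of_nonneg (Int.emod_nonneg j h0.ne')]
        exact (Int.mod_modEq j _).symm.dvd
    · rintro ⟨j, -, rfl⟩
      exact ⟨j, rfl⟩
  rw [this, Set.InjOn.ncard_image]
  · simp [Set.ncard_eq_toFinset_card']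
  · intro a ha b hb hab
    simp only [galois_eq_galois_iff, Set.mem_Iio] at ha hb hab
    have h := Int.emod_eq_emod_iff_emod_sub_eq_zero.2 (Int.emod_eq_zero_of_dvd hab)
    rw [Int.emod_eq_of_lt (by omega) (by omega), Int.emod_eq_of_lt (by omega) (by omega)] at h
    exact_mod_cast h

/-- `q ≠ 0` is special if and only if `-q` is a Galois conjugate of `q`. -/
theorem isSpecial_iff {q : ExpFactor} : IsSpecial q ↔ q ≠ 0 ∧ ∃ j : ℤ, galois j q = -q := by
  refine and_congr_right fun h0 => ?_
  set R := Set.range fun j : ℤ => galois j q with hR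
  have hRc : R.ncard = ram q := ncard_range_galois q
  have hcirc : circle q = R ∪ (fun x => -x) '' R := by
    ext x
    rw [Set.mem_union, ← Set.range_comp]
    simp only [circle, Set.mem_ofPred_eq, hR, Set.mem_range, Function.comp_apply, exists_or,
      eq_comm]
  have hneg : ∀ i j : ℤ, galois i q = -galois j q → galois (i - j) q = -q := by
    intro i j h
    have h1 : twist 1 i q = twist (-1) j q := by simpa [twist] using h
    have := congrArg (twist 1 (-j)) h1
    rw [twist_twist, twist_twist, neg_add_eq_sub, neg_add_cancel] at this
    rw [twist_zero_right] at this
    simpa [twist] using this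
  constructor
  · intro h
    by_contra hno
    have hfin : R.Finite := Set.finite_of_ncard_pos (by rw [hRc]; exact ram_pos q)
    have hdis : Disjoint R ((fun x => -x) '' R) := by
      rw [Set.disjoint_left]
      rintro _ ⟨i, rfl⟩ ⟨_, ⟨j, rfl⟩, hj⟩
      exact hno ⟨_, hneg i j hj.symm⟩
    rw [hcirc, Set.ncard_union_eq hdis hfin (hfin.image _), Set.ncard_image_of_injective _
      neg_injective, hRc] at h
    have := ram_pos q
    omega
  · rintro ⟨j, hj⟩
    rw [hcirc, Set.union_eq_left.2, hRc]
    rintro _ ⟨_, ⟨i, rfl⟩, rfl⟩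
    refine ⟨i + j, ?_⟩
    have h1 : twist 1 j q = twist (-1) 0 q := by rw [twist_zero_right]; simpa [twist] using hj
    have := congrArg (twist 1 i) h1
    rw [twist_twist, twist_twist] at this
    simpa [twist] using this

theorem isSpecial_congr {q q' : ExpFactor} (h : levelBC q = levelBC q') :
    IsSpecial q ↔ IsSpecial q' := by
  rw [isSpecial_iff, isSpecial_iff, Ne, Ne, eq_zero_congr h]
  refine and_congr_right fun _ => exists_congr fun j => ?_
  simpa using galois_eq_smul_congr h (-1) j

open scoped Classical in
/-- The number of conjugates of `q` up to sign. -/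
def sheets (q : ExpFactor) : ℕ := if IsSpecial q then ram q / 2 else ram q

/-- The period of `q` up to sign is the number of sheets. -/
theorem exists_galois_eq_smul_iff {j : ℤ} {q : ExpFactor} :
    (∃ e : ℤˣ, galois j q = (e : ℤ) • q) ↔ (sheets q : ℤ) ∣ j := by
  have hsplit : (∃ e : ℤˣ, galois j q = (e : ℤ) • q) ↔ galois j q = q ∨ galois j q = -q := by
    constructor
    · rintro ⟨e, he⟩
      rcases Int.units_eq_one_or e with rfl | rfl
      · left; simpa using he
      · right; simpa using he
    · rintro (h | h)
      · exact ⟨1, by simpa using h⟩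
      · exact ⟨-1, by simpa using h⟩
  rw [hsplit]
  by_cases hs : IsSpecial q
  · obtain ⟨h0, i, hi⟩ := isSpecial_iff.1 hs
    have hnd : ¬ (ram q : ℤ) ∣ i := by
      rw [← galois_eq_self_iff, hi]; exact neg_ne_self h0
    -- `galois j q = - q = galois i q` if and only if `j ≡ i` modulo the ramification
    have hneg : galois j q = -q ↔ (ram q : ℤ) ∣ j - i := by rw [← hi, galois_eq_galois_iff]
    have h2 : (ram q : ℤ) ∣ 2 * i := by
      have h1 : twist 1 i q = twist (-1) 0 q := by rw [twist_zero_right]; simpa [twist] using hi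
      have h3 : twist 1 (i + i) q = twist (-1) 0 (twist 1 i q) := by
        have := congrArg (twist 1 i) h1
        rw [twist_twist, twist_twist, one_mul] at this
        rw [this, twist_twist]
        simp
      rw [← galois_eq_self_iff, ← twist_one_left, two_mul, h3, h1, twist_twist]
      simp
    rw [galois_eq_self_iff, hneg, sheets, if_pos hs]
    obtain ⟨t, ht⟩ := h2
    have hodd : ¬ (2 : ℤ) ∣ t := by
      rintro ⟨u, rfl⟩
      exact hnd ⟨u, by linarith⟩
    have heven : (2 : ℤ) ∣ ram q := by
      have : (2 : ℤ) ∣ ram q * t := ⟨i, ht.symm⟩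
      exact (Int.prime_two.dvd_or_dvd this).resolve_right hodd
    obtain ⟨N, hN⟩ : ∃ N : ℕ, ram q = 2 * N := by exact_mod_cast heven
    obtain ⟨u, rfl⟩ : ∃ u, t = 2 * u + 1 := by exact ⟨t / 2, by omega⟩
    rw [hN, Nat.mul_div_cancel_left _ two_pos]
    have hi' : i = N * (2 * u + 1) := by
      rw [hN] at ht; push_cast at ht; linarith
    subst hi'
    constructor
    · rintro (⟨v, rfl⟩ | ⟨v, hv⟩)
      · exact ⟨2 * v, by push_cast; ring⟩
      · refine ⟨2 * v + 2 * u + 1, ?_⟩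
        push_cast at hv
        linear_combination hv
    · rintro ⟨v, rfl⟩
      rcases Int.even_or_odd' v with ⟨w, rfl | rfl⟩
      · left; exact ⟨w, by push_cast; ring⟩
      · right; exact ⟨w - u, by push_cast; ring⟩
  · rw [sheets, if_neg hs, ← galois_eq_self_iff, or_iff_left_iff_imp]
    intro h
    by_cases h0 : q = 0
    · rw [h, h0, neg_zero]
    · exact absurd (isSpecial_iff.2 ⟨h0, j, h⟩) hs

theorem sheets_pos (q : ExpFactor) : 0 < sheets q := by
  refine Nat.pos_of_ne_zero fun h => ?_
  have : (sheets q : ℤ) ∣ ram q := by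
    rw [← exists_galois_eq_smul_iff]
    exact ⟨1, by rw [galois_eq_self_iff.2 dvd_rfl]; simp⟩
  rw [h] at this
  have h0 := ram_pos q
  simp only [Nat.cast_zero, zero_dvd_iff] at this
  omega

theorem sheets_congr {q q' : ExpFactor} (h : levelBC q = levelBC q') : sheets q = sheets q' := by
  have key : ∀ j : ℤ, (sheets q : ℤ) ∣ j ↔ (sheets q' : ℤ) ∣ j := by
    intro j
    rw [← exists_galois_eq_smul_iff, ← exists_galois_eq_smul_iff]
    exact exists_congr fun e => galois_eq_smul_congr h e j
  refine Nat.dvd_antisymm ?_ ?_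
  · exact_mod_cast (key _).2 dvd_rfl
  · exact_mod_cast (key _).1 dvd_rfl

theorem galois_sheets {q : ExpFactor} {e : ℤˣ} (he : q ≠ 0 → (e = -1 ↔ IsSpecial q)) :
    galois (sheets q) q = (e : ℤ) • q := by
  by_cases h0 : q = 0
  · subst h0
    rw [← twist_one_left]; simp
  have he := he h0
  obtain ⟨e', h⟩ := exists_galois_eq_smul_iff.2 (dvd_refl (sheets q : ℤ))
  suffices e' = e by rw [h, this]
  by_cases hs : IsSpecial q
  · rw [he.2 hs]
    refine (Int.units_eq_one_or e').resolve_left ?_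
    rintro rfl
    -- the number of sheets `ram q / 2` of a special `q` is not a period
    have h1 : (ram q : ℤ) ∣ sheets q := by
      rw [← galois_eq_self_iff, h]; simp
    have h2 := Nat.le_of_dvd (sheets_pos q) (by exact_mod_cast h1)
    rw [sheets, if_pos hs] at h2
    have := ram_pos q
    omega
  · have h1 : e = 1 := (Int.units_eq_one_or e).resolve_right fun h => hs (he.1 h)
    rw [h1]
    refine (Int.units_eq_one_or e').resolve_right ?_
    rintro rfl
    exact hs (isSpecial_iff.2 ⟨h0, sheets q, by simpa using h⟩)

/-- Every twist of `q` is, up to sign, one of the first `sheets q` conjugates. -/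
theorem exists_twist_eq (e : ℤˣ) (j : ℤ) (q : ExpFactor) :
    ∃ (e' : ℤˣ) (a : ℕ), a < sheets q ∧ twist e j q = twist e' a q := by
  have h0 : (0 : ℤ) < sheets q := by exact_mod_cast sheets_pos q
  have hr := Int.emod_nonneg j h0.ne'
  have hl := Int.emod_lt_of_pos j h0
  obtain ⟨e', he'⟩ := exists_galois_eq_smul_iff.2 (Dvd.intro _ rfl :
    (sheets q : ℤ) ∣ sheets q * (j / sheets q))
  refine ⟨e * e', (j % sheets q).toNat, by omega, ?_⟩
  have h1 : twist 1 (sheets q * (j / sheets q)) q = twist e' 0 q := by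
    rw [twist_zero_right, ← he', twist_one_left]
  have := congrArg (twist e (j % sheets q)) h1
  rw [twist_twist, twist_twist, Int.emod_add_mul_ediv] at this
  rw [Int.toNat_of_nonneg hr]
  simpa using this

theorem eq_of_twist_eq_twist {q : ExpFactor} {e e' : ℤˣ} {a b : ℕ} (ha : a < sheets q)
    (hb : b < sheets q) (h : twist e a q = twist e' b q) : a = b := by
  have h1 : (sheets q : ℤ) ∣ (a : ℤ) - b := by
    rw [← exists_galois_eq_smul_iff]
    refine ⟨e * e', ?_⟩
    rw [galois_eq_smul_iff, ← slope_twist_sub_twist, h, sub_self, slope_zero]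
  have h2 := Int.emod_eq_emod_iff_emod_sub_eq_zero.2 (Int.emod_eq_zero_of_dvd h1)
  rw [Int.emod_eq_of_lt (by omega) (by omega), Int.emod_eq_of_lt (by omega) (by omega)] at h2
  exact_mod_cast h2

theorem sheets_eq_one_iff {q : ExpFactor} :
    sheets q = 1 ↔ ∃ e : ℤˣ, galois 1 q = (e : ℤ) • q := by
  rw [exists_galois_eq_smul_iff]
  constructor
  · intro h; rw [h]; simp
  · intro h; exact Nat.dvd_one.1 (by exact_mod_cast h)

/-! ### Fission exponents -/

@[simp] theorem trunc_apply (k : NNRat) (q : ExpFactor) (l : Exponent) [Decidable (k ≤ l.1)] :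
    trunc k q l = if k ≤ l.1 then q l else 0 := by
  simp [trunc, Finsupp.filter_apply]

theorem trunc_twist (k : NNRat) (e : ℤˣ) (j : ℤ) (q : ExpFactor) :
    trunc k (twist e j q) = twist e j (trunc k q) := by
  classical
  ext l
  by_cases h : k ≤ l.1 <;> simp [twist_apply, h]

theorem apply_ne_zero_of_circle_eq {q q' : ExpFactor} (h : circle q = circle q') (k : Exponent) :
    q k ≠ 0 ↔ q' k ≠ 0 := by
  obtain ⟨e, j, rfl⟩ := circle_eq_iff.1 h
  exact twist_apply_ne_zero

theorem slope_lt_iff_trunc_eq {q q' : ExpFactor} {k : NNRat} (hk : 0 < k) :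
    slope (q - q') < k ↔ trunc k q = trunc k q' := by
  classical
  constructor
  · intro h
    ext l
    by_cases hl : k ≤ l.1
    · have := slope_le_iff.1 le_rfl l (h.trans_le hl)
      simpa [hl, sub_eq_zero] using this
    · simp [hl]
  · intro h
    by_contra hlt
    rw [not_lt] at hlt
    obtain ⟨l, hl, hl0⟩ := exists_slope_eq (hk.trans_le hlt).ne'
    have := DFunLike.congr_fun h l
    simp only [trunc_apply, hl, hlt, if_true] at this
    exact hl0 (by simp [this])

theorem circle_trunc_eq_iff {q q' : ExpFactor} {k : NNRat} (hk : 0 < k) :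
    circle (trunc k q) = circle (trunc k q') ↔ ∃ e j, slope (twist e j q - q') < k := by
  simp only [circle_eq_iff', slope_lt_iff_trunc_eq hk, trunc_twist]

theorem slope_sub_commonPart_le_iff {q q' : ExpFactor} {s : NNRat} :
    slope (q - commonPart q q') ≤ s ↔
      ∀ k : Exponent, s < k.1 → q k ≠ 0 → circle (trunc k.1 q) = circle (trunc k.1 q') := by
  classical
  rw [slope_le_iff]
  refine forall₂_congr fun k _ => ?_
  rw [Finsupp.sub_apply, commonPart, Finsupp.filter_apply]
  split_ifs with h
  · simp [h]
  · simp only [h, sub_zero, imp_false, not_not]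

/-- The fission exponent is the smallest distance between the two circles. -/
theorem fissionExp_le_iff {q q' : ExpFactor} {s : NNRat} :
    fissionExp q q' ≤ s ↔ ∃ e j, slope (twist e j q - q') ≤ s := by
  rw [fissionExp, max_le_iff, slope_sub_commonPart_le_iff, slope_sub_commonPart_le_iff]
  constructor
  · rintro ⟨h1, h2⟩
    have h : ∀ k ∈ (q.support ∪ q'.support).filter fun k => s < k.1,
        circle (trunc k.1 q) = circle (trunc k.1 q') := by
      intro k hk
      rw [Finset.mem_filter, Finset.mem_union, Finsupp.mem_support_iff,
        Finsupp.mem_support_iff] at hk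
      obtain ⟨hk | hk, hs⟩ := hk
      · exact h1 k hs hk
      · exact (h2 k hs hk).symm
    -- compare `q` and `q'` at the smallest active exponent above `s`
    rcases ((q.support ∪ q'.support).filter fun k => s < k.1).eq_empty_or_nonempty with h0 | hne
    · refine ⟨1, 0, ?_⟩
      rw [twist_one_zero, slope_le_iff]
      intro k hk
      have : k ∉ (q.support ∪ q'.support).filter fun k => s < k.1 := by simp [h0]
      simp only [Finset.mem_filter, hk, and_true, Finset.mem_union, Finsupp.mem_support_iff,
        not_or, not_not] at this
      simp [this]
    · obtain ⟨k, hk, hmin⟩ := Finset.exists_min_image _ (fun k : Exponent => k.1) hne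
      obtain ⟨e, j, hlt⟩ := (circle_trunc_eq_iff k.2).1 (h k hk)
      refine ⟨e, j, slope_le_iff.2 fun l hl => ?_⟩
      by_contra hl0
      have hl' : l ∈ (q.support ∪ q'.support).filter fun k => s < k.1 := by
        simp only [Finset.mem_filter, hl, and_true, Finset.mem_union, Finsupp.mem_support_iff]
        by_contra hno
        rw [not_or, not_not, not_not] at hno
        exact hl0 (by simp [twist_apply, hno])
      exact absurd (hlt.trans_le (hmin l hl')) (not_lt.2 (le_slope hl0))
  · rintro ⟨e, j, h⟩
    have key : ∀ k : Exponent, s < k.1 → circle (trunc k.1 q) = circle (trunc k.1 q') :=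
      fun k hk => (circle_trunc_eq_iff k.2).2 ⟨e, j, h.trans_lt hk⟩
    exact ⟨fun k hk _ => key k hk, fun k hk _ => (key k hk).symm⟩

theorem fissionExp_le (e : ℤˣ) (j : ℤ) (q q' : ExpFactor) :
    fissionExp q q' ≤ slope (twist e j q - q') :=
  fissionExp_le_iff.2 ⟨e, j, le_rfl⟩

theorem exists_slope_eq_fissionExp (q q' : ExpFactor) :
    ∃ e j, slope (twist e j q - q') = fissionExp q q' := by
  obtain ⟨e, j, h⟩ := fissionExp_le_iff.1 (le_refl (fissionExp q q'))
  exact ⟨e, j, le_antisymm h (fissionExp_le e j q q')⟩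

theorem fissionExp_comm (q q' : ExpFactor) : fissionExp q q' = fissionExp q' q := max_comm _ _

theorem fissionExp_eq_zero {q q' : ExpFactor} (h : circle q = circle q') :
    fissionExp q q' = 0 := by
  obtain ⟨e, j, rfl⟩ := circle_eq_iff'.1 h
  have := fissionExp_le e j q (twist e j q)
  simpa using this

/-- The fission exponent is an ultrametric. -/
theorem fissionExp_le_max (a b c : ExpFactor) :
    fissionExp a c ≤ max (fissionExp a b) (fissionExp b c) := by
  obtain ⟨e, j, h⟩ := exists_slope_eq_fissionExp a b
  obtain ⟨e', j', h'⟩ := exists_slope_eq_fissionExp b c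
  rw [← h, ← h', ← slope_twist e' j', twist_sub, twist_twist]
  exact (fissionExp_le _ _ _ _).trans (slope_sub_le_max _ _ _)

theorem fissionExp_congr {q q' x x' : ExpFactor} (h : circle q = circle x)
    (h' : circle q' = circle x') : fissionExp q q' = fissionExp x x' := by
  have key : ∀ {q q' x x' : ExpFactor}, circle q = circle x → circle q' = circle x' →
      fissionExp q q' ≤ fissionExp x x' := by
    intro q q' x x' h h'
    refine (fissionExp_le_max q x q').trans (max_le ?_ ((fissionExp_le_max x x' q').trans
      (max_le le_rfl ?_)))
    · simp [fissionExp_eq_zero h]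
    · simp [fissionExp_eq_zero h'.symm]
  exact le_antisymm (key h h') (key h.symm h'.symm)

/-- If `q` and `q'` realize the distance of their circles, then any other distance between these
circles is determined by the fission exponent and the level datum of `q`. -/
theorem slope_twist_sub_of_compatible {q q' : ExpFactor} (h : slope (q - q') ≤ fissionExp q q')
    (e : ℤˣ) (j : ℤ) :
    slope (twist e j q - q') = max (slope (twist e j q - q)) (fissionExp q q') := by
  refine le_antisymm ((slope_sub_le_max _ q _).trans (max_le_max le_rfl h))
    (max_le ((slope_sub_le_max _ q' _).trans (max_le le_rfl ?_)) (fissionExp_le _ _ _ _))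
  rw [slope_sub_comm]
  exact h.trans (fissionExp_le _ _ _ _)

/-- The common part vanishes if and only if the circles are as far apart as their slopes allow. -/
theorem commonPart_eq_zero_iff {q q' : ExpFactor} :
    commonPart q q' = 0 ↔ max (slope q) (slope q') ≤ fissionExp q q' := by
  classical
  constructor
  · intro h
    have h' : commonPart q' q = 0 := by
      ext k
      rw [commonPart, Finsupp.filter_apply]
      split_ifs with hc
      · have hk := DFunLike.congr_fun h k
        rw [commonPart, Finsupp.filter_apply, if_pos hc.symm] at hk
        by_contra hk'
        have := (apply_ne_zero_of_circle_eq hc k).1 (by simpa using hk')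
        simp only [trunc_apply, le_refl, if_true] at this
        exact this hk
      · rfl
    rw [fissionExp, h, h', sub_zero, sub_zero]
  · intro h
    ext k
    rw [commonPart, Finsupp.filter_apply]
    split_ifs with hc
    · by_contra hk
      obtain ⟨e, j, hlt⟩ := (circle_trunc_eq_iff k.2).1 hc
      have h1 := (fissionExp_le e j q q').trans_lt hlt
      exact absurd ((le_slope hk).trans ((le_max_left _ _).trans h)) (not_le.2 h1)
    · rfl

/-! ### Compatible representatives -/

theorem compatible_iff {P : PointedType} :
    P.Compatible ↔
      ∀ i j, i ≠ j → slope (P.q i - P.q j) ≤ fissionExp (P.q i) (P.q j) := by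
  constructor
  · intro h i j hij
    by_contra hlt
    rw [not_le] at hlt
    have hk : 0 < slope (P.q i - P.q j) := (zero_le).trans_lt hlt
    obtain ⟨e, k, hek⟩ := exists_slope_eq_fissionExp (P.q i) (P.q j)
    have := h _ hk i j hij ((circle_trunc_eq_iff hk).2 ⟨e, k, hek ▸ hlt⟩)
    exact absurd ((slope_lt_iff_trunc_eq hk).2 this) (lt_irrefl _)
  · intro h k hk i j hij hc
    obtain ⟨e, l, hlt⟩ := (circle_trunc_eq_iff hk).1 hc
    exact (slope_lt_iff_trunc_eq hk).1 ((h i j hij).trans_lt ((fissionExp_le e l _ _).trans_lt hlt))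

/-- Finitely many circles have representatives that realize all mutual distances: a new circle is
represented by a point closest to the representative of one of the closest old circles. -/
theorem exists_compatible {ι : Type*} (q : ι → ExpFactor) (S : Finset ι) :
    ∃ q' : ι → ExpFactor, (∀ i, circle (q' i) = circle (q i)) ∧
      ∀ i ∈ S, ∀ j ∈ S, slope (q' i - q' j) ≤ fissionExp (q i) (q j) := by
  classical
  induction S using Finset.induction_on with
  | empty => exact ⟨q, fun _ => rfl, by simp⟩
  | insert n S hn ih =>
    obtain ⟨q', hq', hS⟩ := ih
    rcases S.eq_empty_or_nonempty with rfl | hne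
    · exact ⟨q, fun _ => rfl, by simp⟩
    obtain ⟨i, hi, hmin⟩ := Finset.exists_min_image S (fun i => fissionExp (q i) (q n)) hne
    obtain ⟨e, j, hej⟩ := exists_slope_eq_fissionExp (q n) (q' i)
    rw [fissionExp_congr rfl (hq' i), fissionExp_comm] at hej
    have hnew : ∀ l ∈ S, slope (q' l - twist e j (q n)) ≤ fissionExp (q l) (q n) := by
      intro l hl
      refine (slope_sub_le_max _ (q' i) _).trans (max_le ((hS l hl i hi).trans ?_) ?_)
      · refine (fissionExp_le_max _ (q n) _).trans (max_le le_rfl ?_)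
        rw [fissionExp_comm]
        exact hmin l hl
      · rw [slope_sub_comm, hej]
        exact hmin l hl
    refine ⟨Function.update q' n (twist e j (q n)), fun l => ?_, ?_⟩
    · by_cases hl : l = n
      · subst hl; simp
      · simp [hl, hq']
    · have hne' : ∀ l ∈ S, l ≠ n := fun l hl h => hn (h ▸ hl)
      intro a ha b hb
      rcases Finset.mem_insert.1 ha with rfl | ha' <;> rcases Finset.mem_insert.1 hb with rfl | hb'
      · simp
      · rw [Function.update_self, Function.update_of_ne (hne' b hb'), slope_sub_comm,
          fissionExp_comm]
        exact hnew b hb'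
      · rw [Function.update_self, Function.update_of_ne (hne' a ha')]
        exact hnew a ha'
      · rw [Function.update_of_ne (hne' a ha'), Function.update_of_ne (hne' b hb')]
        exact hS a ha' b hb'

/-! ### Multiplicities in Galois-closed tuples -/

theorem exists_eq_twist_comm {x y : ExpFactor} :
    (∃ e : ℤˣ, x = twist e 0 y) ↔ ∃ e : ℤˣ, y = twist e 0 x := by
  constructor <;>
  · rintro ⟨e, rfl⟩
    exact ⟨e, by simp [twist_twist]⟩

theorem eq_twist_iff_slope {e : ℤˣ} {x y : ExpFactor} :
    twist e 0 x = y ↔ slope (twist e 0 x - y) = 0 := by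
  rw [slope_eq_zero_iff, sub_eq_zero]

open scoped Classical in
/-- The number of positions at which `x` or `-x` occurs in the tuple `Q`. -/
def pairCount {m : ℕ} (Q : Fin m → ExpFactor) (x : ExpFactor) : ℕ :=
  (Finset.univ.filter fun y => ∃ e : ℤˣ, Q y = twist e 0 x).card

theorem occurrences_eq {m : ℕ} (Q : Fin m → ExpFactor) (x : ExpFactor) [Decidable (x = 0)] :
    occurrences Q x = (if x = 0 then 2 else 1) * pairCount Q x := by
  classical
  rw [occurrences, pairCount, Finset.card_filter, Finset.mul_sum]
  refine Finset.sum_congr rfl fun y _ => ?_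
  have h : (∃ e : ℤˣ, Q y = twist e 0 x) ↔ Q y = x ∨ -Q y = x := by
    constructor
    · rintro ⟨e, he⟩
      rw [twist_zero_right] at he
      rcases Int.units_eq_one_or e with rfl | rfl
      · left; simpa using he
      · right; simp [he]
    · rintro (h | h)
      · exact ⟨1, by simp [h]⟩
      · exact ⟨-1, by rw [twist_zero_right, ← h]; simp⟩
  simp only [h]
  by_cases h0 : x = 0
  · subst h0
    by_cases hy : Q y = 0 <;> simp [hy]
  · rw [if_neg h0, one_mul]
    by_cases h1 : Q y = x
    · rw [h1]
      simp [neg_ne_self h0]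
    · simp [h1]

theorem multBC_eq {m : ℕ} (Q : Fin m → ExpFactor) (x : ExpFactor) [Decidable (IsSpecial x)] :
    multBC Q x = if IsSpecial x then (pairCount Q x : ℚ) / 2 else pairCount Q x := by
  classical
  rw [multBC, occurrences_eq]
  by_cases h0 : x = 0
  · have : ¬ IsSpecial x := fun h => h.1 h0
    simp [h0, h0 ▸ this]
  · simp [h0]

/-- A tuple whose Galois-orbit is generated by `g` is stable under all twists, and the way these
permute the positions depends on `g` only. -/
theorem SignedPerm.exists_twist_eq {m : ℕ} (g : SignedPerm m) (e : ℤˣ) (j : ℤ) (x : Fin m) :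
    ∃ (e' : ℤˣ) (z : Fin m), ∀ Q : Fin m → ExpFactor, g.Generates Q →
      twist e j (Q x) = twist e' 0 (Q z) := by
  have h1 : ∀ Q : Fin m → ExpFactor, g.Generates Q → ∀ x,
      twist 1 1 (Q x) = twist (g.sign x) 0 (Q (g.perm x)) := by
    intro Q hQ x
    rw [twist_one_left, hQ x, twist_zero_right]
    rfl
  induction j using Int.induction_on with
  | zero => exact ⟨e, x, fun _ _ => rfl⟩
  | succ j ih =>
    obtain ⟨e', z, hz⟩ := ih
    refine ⟨e' * g.sign z, g.perm z, fun Q hQ => ?_⟩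
    have := congrArg (twist 1 1) (hz Q hQ)
    rw [twist_twist, twist_twist, one_mul, one_mul, add_comm] at this
    rw [this, ← add_zero (0 : ℤ), ← twist_twist, ← h1 Q hQ z, twist_twist]
    simp
  | pred j ih =>
    obtain ⟨e', z, hz⟩ := ih
    refine ⟨e' * g.sign (g.perm.symm z), g.perm.symm z, fun Q hQ => ?_⟩
    have h2 := congrArg (twist (g.sign (g.perm.symm z)) (-1)) (h1 Q hQ (g.perm.symm z))
    have := congrArg (twist 1 (-1)) (hz Q hQ)
    rw [twist_twist, twist_twist] at h2 this
    rw [Equiv.apply_symm_apply] at h2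
    rw [← add_zero (0 : ℤ), ← twist_twist, sub_eq_neg_add, ← one_mul e, this]
    simp only [mul_one, neg_add_cancel, Int.units_mul_self, add_zero] at h2
    rw [h2, twist_twist]
    simp

theorem pairCount_congr {m : ℕ} {Q : Fin m → ExpFactor} (hQ : ∃ g : SignedPerm m, g.Generates Q)
    {x x' : ExpFactor} (h : circle x = circle x') : pairCount Q x = pairCount Q x' := by
  classical
  obtain ⟨g, hg⟩ := hQ
  have h0 : ∀ e x, pairCount Q (twist e 0 x) = pairCount Q x := by
    intro e x
    unfold pairCount
    congr 1
    refine Finset.filter_congr fun y _ => ?_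
    rw [exists_eq_twist_comm, exists_eq_twist_comm (y := x)]
    constructor
    · rintro ⟨e', he'⟩
      exact ⟨e * e', by rw [← add_zero (0 : ℤ), ← twist_twist, ← he', twist_twist]; simp⟩
    · rintro ⟨e', rfl⟩
      exact ⟨e * e', by rw [twist_twist]; simp⟩
  have h1 : ∀ x, pairCount Q (twist 1 1 x) = pairCount Q x := by
    intro x
    symm
    refine Finset.card_equiv g.perm fun y => ?_
    simp only [Finset.mem_filter, Finset.mem_univ, true_and]
    have hgy : twist 1 1 (Q y) = twist (g.sign y) 0 (Q (g.perm y)) := by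
      rw [twist_one_left, hg y, twist_zero_right]
      rfl
    constructor
    · rintro ⟨e, he⟩
      refine ⟨g.sign y * e, ?_⟩
      rw [he, twist_twist] at hgy
      have := congrArg (twist (g.sign y) 0) hgy
      rw [twist_twist, twist_twist] at this
      rw [twist_twist]
      simpa using this.symm
    · rintro ⟨e, he⟩
      refine ⟨g.sign y * e, ?_⟩
      rw [he, twist_twist, twist_twist] at hgy
      have := congrArg (twist 1 (-1)) hgy
      rw [twist_twist, twist_twist] at this
      simpa using this
  have h2 : ∀ (j : ℤ) x, pairCount Q (twist 1 j x) = pairCount Q x := by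
    intro j
    induction j using Int.induction_on with
    | zero => intro x; simp
    | succ j ih => intro x; rw [← ih x, ← h1 (twist 1 j x), twist_twist, mul_one, add_comm]
    | pred j ih => intro x; rw [← ih x, ← h1 (twist 1 (-j - 1) x), twist_twist]; simp
  obtain ⟨e, j, rfl⟩ := circle_eq_iff.1 h
  rw [show twist e j x' = twist e 0 (twist 1 j x') by rw [twist_twist]; simp, h0, h2]

/-! ### Invariants of admissible deformations -/

/-- The relation underlying both kinds of admissible deformations: a common generator of the
Galois-orbits and the same mutual slopes. In type `D` nothing is said about `slope (Q x)`. -/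
structure Agree {m : ℕ} (Q Q' : Fin m → ExpFactor) : Prop where
  generates : ∃ g : SignedPerm m, g.Generates Q ∧ g.Generates Q'
  slope_eq : ∀ x y, x ≠ y → ∀ e : ℤˣ,
    slope (twist e 0 (Q x) - Q y) = slope (twist e 0 (Q' x) - Q' y)

theorem slope_twist_zero_sub (q q' x x' : ExpFactor)
    (h : slope (q + q') = slope (x + x') ∧ slope (q - q') = slope (x - x')) (e : ℤˣ) :
    slope (twist e 0 q - q') = slope (twist e 0 x - x') := by
  rcases Int.units_eq_one_or e with rfl | rfl
  · simpa using h.2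
  · rw [← slope_neg, ← slope_neg (twist _ _ _ - x'), twist_zero_right, twist_zero_right]
    simpa [add_comm] using h.1

namespace Agree

variable {m : ℕ} {Q Q' : Fin m → ExpFactor}

theorem symm (h : Agree Q Q') : Agree Q' Q :=
  ⟨h.generates.imp fun _ hg => ⟨hg.2, hg.1⟩, fun x y hxy e => (h.slope_eq x y hxy e).symm⟩

theorem twist_eq_of_twist_eq (h : Agree Q Q') {x y : Fin m} {e : ℤˣ} (hxy : x ≠ y)
    (hQ : twist e 0 (Q x) = Q y) : twist e 0 (Q' x) = Q' y := by
  rw [eq_twist_iff_slope] at hQ ⊢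
  rwa [← h.slope_eq x y hxy]

theorem circle_eq_of_circle_eq (h : Agree Q Q') {x y : Fin m} (hxy : circle (Q x) = circle (Q y)) :
    circle (Q' x) = circle (Q' y) := by
  obtain ⟨e, j, hej⟩ := circle_eq_iff'.1 hxy
  obtain ⟨g, hg, hg'⟩ := h.generates
  obtain ⟨e', z, hz⟩ := g.exists_twist_eq e j x
  rw [← circle_twist e j, hz Q' hg']
  rw [hz Q hg] at hej
  by_cases hzy : z = y
  · rw [hzy, circle_twist]
  · rw [h.twist_eq_of_twist_eq hzy hej]

theorem circle_eq_iff (h : Agree Q Q') {x y : Fin m} :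
    circle (Q x) = circle (Q y) ↔ circle (Q' x) = circle (Q' y) :=
  ⟨h.circle_eq_of_circle_eq, h.symm.circle_eq_of_circle_eq⟩

theorem fissionExp_le (h : Agree Q Q') (x y : Fin m) :
    fissionExp (Q' x) (Q' y) ≤ fissionExp (Q x) (Q y) := by
  by_cases hc : circle (Q x) = circle (Q y)
  · rw [fissionExp_eq_zero hc, fissionExp_eq_zero (h.circle_eq_of_circle_eq hc)]
  obtain ⟨e, j, hej⟩ := exists_slope_eq_fissionExp (Q x) (Q y)
  obtain ⟨g, hg, hg'⟩ := h.generates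
  obtain ⟨e', z, hz⟩ := g.exists_twist_eq e j x
  have hzy : z ≠ y := by
    rintro rfl
    exact hc (by rw [← circle_twist e j, hz Q hg, circle_twist])
  rw [← hej, hz Q hg, h.slope_eq z y hzy, ← hz Q' hg']
  exact Fission.fissionExp_le _ _ _ _

theorem fissionExp_eq (h : Agree Q Q') (x y : Fin m) :
    fissionExp (Q x) (Q y) = fissionExp (Q' x) (Q' y) :=
  le_antisymm (h.symm.fissionExp_le x y) (h.fissionExp_le x y)

theorem max_slope_eq (h : Agree Q Q') {x y : Fin m} (hxy : x ≠ y) :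
    max (slope (Q x)) (slope (Q y)) = max (slope (Q' x)) (slope (Q' y)) := by
  have h1 := h.slope_eq x y hxy 1
  have h2 := h.slope_eq x y hxy (-1)
  rw [twist_one_zero, twist_one_zero] at h1
  rw [← slope_neg, ← slope_neg (twist _ _ _ - Q' y), twist_zero_right, twist_zero_right] at h2
  simp only [Units.val_neg, Units.val_one, neg_smul, one_smul, neg_sub, sub_neg_eq_add] at h2
  rw [← max_slope_add_sub, ← max_slope_add_sub (Q' x), h1, add_comm (Q x), add_comm (Q' x), h2]

/-- The slope at a position is determined if the circle occupies another position as well. -/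
theorem slope_eq_of_circle_eq (h : Agree Q Q') {x y : Fin m} (hxy : x ≠ y)
    (hc : circle (Q x) = circle (Q y)) : slope (Q x) = slope (Q' x) := by
  have := h.max_slope_eq hxy
  rwa [← slope_congr hc, ← slope_congr (h.circle_eq_of_circle_eq hc), max_self, max_self] at this

theorem levelBC_eq (h : Agree Q Q') {x : Fin m} (hx : slope (Q x) = slope (Q' x)) :
    levelBC (Q x) = levelBC (Q' x) := by
  rw [levelBC_eq_iff]
  intro e j
  obtain ⟨g, hg, hg'⟩ := h.generates
  obtain ⟨e', z, hz⟩ := g.exists_twist_eq e j x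
  rw [hz Q hg, hz Q' hg']
  by_cases hzx : z = x
  · subst hzx
    rcases Int.units_eq_one_or e' with rfl | rfl
    · simp
    · rw [twist_neg_one_zero_slope, twist_neg_one_zero_slope, hx]
  · exact h.slope_eq z x hzx e'

theorem exists_eq_twist_iff (h : Agree Q Q') (x y : Fin m) :
    (∃ e : ℤˣ, Q y = twist e 0 (Q x)) ↔ ∃ e : ℤˣ, Q' y = twist e 0 (Q' x) := by
  by_cases hxy : x = y
  · subst hxy
    exact iff_of_true ⟨1, by simp⟩ ⟨1, by simp⟩
  · refine exists_congr fun e => ?_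
    rw [eq_comm, eq_twist_iff_slope, h.slope_eq x y hxy, ← eq_twist_iff_slope, eq_comm]

theorem pairCount_eq (h : Agree Q Q') (x : Fin m) : pairCount Q (Q x) = pairCount Q' (Q' x) := by
  classical
  unfold pairCount
  simp only [h.exists_eq_twist_iff]

end Agree

theorem AdmissibleBC.agree {m : ℕ} {Q Q' : Fin m → ExpFactor} (h : AdmissibleBC Q Q') :
    Agree Q Q' ∧ ∀ x, slope (Q x) = slope (Q' x) := by
  obtain ⟨_, hg, h1, h2⟩ := h
  exact ⟨⟨hg, fun x y hxy => slope_twist_zero_sub _ _ _ _ (h1 x y hxy)⟩, h2⟩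

theorem AdmissibleD.agree {m : ℕ} {Q Q' : Fin m → ExpFactor} (h : AdmissibleD Q Q') :
    Agree Q Q' := by
  obtain ⟨_, ⟨g, -, hg⟩, h1⟩ := h
  exact ⟨⟨g, hg⟩, fun x y hxy => slope_twist_zero_sub _ _ _ _ (h1 x y hxy)⟩

/-! ### Level data of type `D` -/

theorem circleList_eq (μ : ℕ) (q : ExpFactor) :
    circleList μ q =
      (List.range (sheets q)).flatMap fun a : ℕ => List.replicate μ (galois (a : ℤ) q) := by
  rw [circleList, ← sheets]
  simp [List.flatMap_assoc]

theorem mem_circleList {μ : ℕ} {q x : ExpFactor} :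
    x ∈ circleList μ q ↔ 0 < μ ∧ ∃ a < sheets q, x = twist 1 a q := by
  rw [circleList_eq, List.mem_flatMap]
  simp only [List.mem_range, List.mem_replicate, twist_one_left]
  constructor
  · rintro ⟨a, ha, h0, rfl⟩
    exact ⟨by omega, a, ha, rfl⟩
  · rintro ⟨h0, a, ha, rfl⟩
    exact ⟨a, ha, by omega, rfl⟩

theorem length_circleList (μ : ℕ) (q : ExpFactor) :
    (circleList μ q).length = sheets q * μ := by
  simp [circleList_eq, List.length_flatMap]

theorem slope_add_eq_twist (q q' : ExpFactor) : slope (q + q') = slope (twist (-1) 0 q - q') := by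
  rw [← slope_neg, twist_zero_right]
  congr 1
  simp only [Units.val_neg, Units.val_one, neg_smul, one_smul, sub_eq_add_neg, neg_add]

/-- Except for a single occurrence of a circle with one sheet, the naive `D`-level datum of a wild
circle is its `BC`-level datum. -/
theorem naiveLevelD_eq {μ : ℕ} {q : ExpFactor} (hμ : 0 < μ)
    (h1 : ¬ (μ = 1 ∧ sheets q = 1)) : naiveLevelD μ q = levelBC q := by
  ext s
  constructor
  · rintro ⟨⟨i, j, -, hs⟩, h0⟩
    obtain ⟨-, a, -, ha⟩ := mem_circleList.1 (List.get_mem (circleList μ q) i)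
    obtain ⟨-, b, -, hb⟩ := mem_circleList.1 (List.get_mem (circleList μ q) j)
    rw [ha, hb] at hs
    refine mem_levelBC_iff.2 ⟨h0, ?_⟩
    rcases hs with rfl | rfl
    · rw [slope_add_eq_twist, twist_twist, slope_twist_sub_twist]
      exact ⟨_, _, rfl⟩
    · rw [slope_twist_sub_twist]
      exact ⟨_, _, rfl⟩
  · intro h
    obtain ⟨h0, e, j, rfl⟩ := mem_levelBC_iff.1 h
    refine ⟨?_, h0⟩
    obtain ⟨e', a, ha, hea⟩ := exists_twist_eq e j q
    rw [hea] at h0 ⊢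
    by_cases ha0 : a = 0
    · -- the distance of `q` to `-q` is `slope q`, which is seen by any two positions
      subst ha0
      have he' : e' = -1 := (Int.units_eq_one_or e').resolve_left (by rintro rfl; simp at h0)
      rw [he', Nat.cast_zero, twist_neg_one_zero_slope]
      have hlen : 1 < (circleList μ q).length := by
        rw [length_circleList]
        have := sheets_pos q
        by_contra hle
        have hle : sheets q * μ = 1 := by
          have := Nat.mul_pos this hμ
          omega
        exact h1 ⟨Nat.eq_one_of_mul_eq_one_left hle, Nat.eq_one_of_mul_eq_one_right hle⟩
      have hsl : ∀ i, slope ((circleList μ q).get i) = slope q := by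
        intro i
        obtain ⟨-, b, -, hb⟩ := mem_circleList.1 (List.get_mem (circleList μ q) i)
        rw [hb, slope_twist]
      refine ⟨⟨0, by omega⟩, ⟨1, hlen⟩, by simp, ?_⟩
      have := max_slope_add_sub ((circleList μ q).get ⟨0, by omega⟩)
        ((circleList μ q).get ⟨1, hlen⟩)
      rw [hsl, hsl, max_self] at this
      rw [← this]
      exact max_choice _ _
    · obtain ⟨i, hi⟩ := List.mem_iff_get.1 (mem_circleList.2 ⟨hμ, a, ha, rfl⟩)
      obtain ⟨k, hk⟩ := List.mem_iff_get.1 (mem_circleList.2 ⟨hμ, 0, sheets_pos q, rfl⟩)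
      refine ⟨i, k, ?_, ?_⟩
      · rintro rfl
        exact ha0 (eq_of_twist_eq_twist ha (sheets_pos q) (hi.symm.trans hk))
      · rw [hi, hk, Nat.cast_zero, twist_one_zero]
        rcases Int.units_eq_one_or e' with rfl | rfl
        · exact Or.inr rfl
        · left
          rw [slope_add_eq_twist, twist_twist]
          simp

theorem sheets_eq_one_iff_ram {q : ExpFactor} :
    q = 0 ∨ ram q = 1 ∨ (IsSpecial q ∧ ram q = 2) ↔ sheets q = 1 := by
  have h0 : q = 0 → ¬ IsSpecial q := fun h h' => h'.1 h
  have h1 : q = 0 → ram q = 1 := by rintro rfl; simp [ram]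
  have hpos := sheets_pos q
  rw [sheets] at hpos ⊢
  by_cases hs : IsSpecial q
  · have hq : q ≠ 0 := hs.1
    simp only [hs, hq, if_true, true_and, false_or] at hpos ⊢
    -- twice the number of sheets is a period, which excludes `ram q = 3`
    have hne : ram q ≠ 3 := by
      intro h3
      obtain ⟨e, he⟩ := exists_galois_eq_smul_iff.2 (dvd_refl (sheets q : ℤ))
      have h4 : (ram q : ℤ) ∣ 2 * sheets q := by
        rw [← galois_eq_self_iff]
        have h5 : twist 1 (sheets q) q = twist e 0 q := by
          rw [twist_zero_right, ← he, twist_one_left]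
        have := congrArg (twist 1 (sheets q)) h5
        rw [twist_twist, twist_twist, one_mul, mul_comm 1, add_comm _ 0,
          ← twist_twist, h5, twist_twist] at this
        rw [← twist_one_left, two_mul, this]
        simp
      rw [sheets, if_pos hs, h3] at h4
      norm_num at h4
    omega
  · simp only [hs, if_false, false_and, or_false]
    tauto

open scoped Classical in
/-- The enhanced level datum in terms of the number of sheets, slopes, fission exponents and the
`BC`-level datum, all of which depend on circles only. -/
theorem levelDIn_eq {p : ℕ} {m : Fin p → ℕ} (q : Fin p → ExpFactor) {i : Fin p} (hm : 0 < m i) :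
    levelDIn m q i =
      if m i = 1 ∧ sheets (q i) = 1 then
        if ∀ j, j ≠ i → max (slope (q i)) (slope (q j)) ≤ fissionExp (q i) (q j) then
          LevelD.emptyD
        else LevelD.levels (levelBC (q i))
      else if q i = 0 then LevelD.emptyBC else LevelD.levels (levelBC (q i)) := by
  simp only [levelDIn, levelD, sheets_eq_one_iff_ram, commonPart_eq_zero_iff]
  by_cases h1 : m i = 1 ∧ sheets (q i) = 1
  · simp [h1]
  · simp only [h1, if_false]
    by_cases h0 : q i = 0
    · simp [h0]
    · simp [h0, naiveLevelD_eq hm h1]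

/-! ### Positions in the full type of a pointed type -/

/-- The places of a full type in their order: the triple `(i, a, c)` stands for the `c`-th copy of
the `a`-th conjugate of the `i`-th exponential factor, which has `N i` sheets and multiplicity
`μ i`. -/
def places {p : ℕ} (N μ : Fin p → ℕ) : List (Fin p × ℕ × ℕ) :=
  (List.finRange p).flatMap fun i => (List.range (N i)).flatMap fun a =>
    (List.range (μ i)).map fun c => (i, a, c)

theorem mem_places {p : ℕ} {N μ : Fin p → ℕ} {t : Fin p × ℕ × ℕ} :
    t ∈ places N μ ↔ t.2.1 < N t.1 ∧ t.2.2 < μ t.1 := by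
  obtain ⟨i, a, c⟩ := t
  simp only [places, List.mem_flatMap, List.mem_finRange, true_and, List.mem_range, List.mem_map,
    Prod.mk.injEq]
  constructor
  · rintro ⟨i', a', ha, c', hc, rfl, rfl, rfl⟩
    exact ⟨ha, hc⟩
  · rintro ⟨ha, hc⟩
    exact ⟨i, a, ha, c, hc, rfl, rfl, rfl⟩

theorem nodup_places {p : ℕ} (N μ : Fin p → ℕ) : (places N μ).Nodup := by
  rw [places, List.nodup_flatMap]
  refine ⟨fun i _ => ?_, (List.nodup_finRange p).imp fun {i j} hij => ?_⟩
  · rw [List.nodup_flatMap]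
    refine ⟨fun a _ => List.nodup_range.map fun c c' h => by simpa using h,
      List.nodup_range.imp fun {a b} hab => ?_⟩
    simp only [Function.onFun, List.disjoint_left, List.mem_map]
    rintro _ ⟨c, -, rfl⟩ ⟨c', -, h⟩
    simp only [Prod.mk.injEq, true_and] at h
    exact hab h.1.symm
  · simp only [Function.onFun, List.disjoint_left, List.mem_map, List.mem_flatMap]
    rintro _ ⟨a, -, c, -, rfl⟩ ⟨a', -, c', -, h⟩
    simp only [Prod.mk.injEq] at h
    exact hij h.1.symm

theorem pairwise_places {p : ℕ} (N μ : Fin p → ℕ) :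
    (places N μ).Pairwise fun s t => s.1 ≤ t.1 := by
  rw [places, List.pairwise_flatMap]
  have hmem : ∀ (i : Fin p) t, t ∈ ((List.range (N i)).flatMap fun a =>
      (List.range (μ i)).map fun c => (i, a, c)) → t.1 = i := by
    intro i t ht
    simp only [List.mem_map, List.mem_flatMap] at ht
    obtain ⟨a, -, c, -, rfl⟩ := ht
    rfl
  refine ⟨fun i _ => List.pairwise_of_forall_mem_list fun s hs t ht => ?_,
    (List.pairwise_lt_finRange p).imp fun {i j} hij s hs t ht => ?_⟩
  · rw [hmem i s hs, hmem i t ht]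
  · rw [hmem i s hs, hmem j t ht]
    exact hij.le

/-- The value of a full type at a place. -/
def placeValue {p : ℕ} (q : Fin p → ExpFactor) (t : Fin p × ℕ × ℕ) : ExpFactor :=
  twist 1 (t.2.1 : ℤ) (q t.1)

theorem PointedType.fullList_eq (P : PointedType) :
    P.fullList = (places (fun i => sheets (P.q i)) P.mult).map (placeValue P.q) := by
  simp only [fullList, places, List.map_flatMap, List.map_map]
  refine congrArg (fun f => List.flatMap f _) (funext fun i => ?_)
  rw [circleList_eq]
  refine congrArg (fun f => List.flatMap f _) (funext fun a => ?_)
  simp only [Function.comp_def, placeValue, twist_one_left]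
  rw [List.map_const', List.length_range]

/-- The positions of a list `T.map F` correspond to the members of `T`, independently of `F`. -/
theorem exists_position_equiv {α β : Type*} {T : List α} (hT : T.Nodup) {F : α → β} {l : List β}
    (hl : l = T.map F) :
    ∃ u : Fin l.length ≃ {t // t ∈ T}, (∀ x, T[x.1]? = some (u x).1) ∧
      (∀ x, l.get x = F (u x).1) ∧
      ∀ R : α → α → Prop, T.Pairwise R → ∀ x y, x < y → R (u x).1 (u y).1 := by
  classical
  subst hl
  refine ⟨(finCongr (List.length_map F)).trans (List.Nodup.getEquiv T hT), fun x => ?_,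
    fun x => ?_, fun R hR x y hxy => ?_⟩
  · simp
  · simp
  · exact List.pairwise_iff_get.1 hR _ _ (by simpa using hxy)

/-- The tuple `Q` is divided by `b` into consecutive blocks, the blocks being the sets of positions
occupied by the pairwise distinct circles of the `q i`. -/
structure Blocks {m p : ℕ} (Q : Fin m → ExpFactor) (q : Fin p → ExpFactor) (b : Fin m → Fin p) :
    Prop where
  mono : Monotone b
  surj : Function.Surjective b
  circle_eq : ∀ x, circle (Q x) = circle (q (b x))
  distinct : ∀ i j, i ≠ j → circle (q i) ≠ circle (q j)

theorem Blocks.eq_iff {m p : ℕ} {Q : Fin m → ExpFactor} {q : Fin p → ExpFactor}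
    {b : Fin m → Fin p} (h : Blocks Q q b) {x y : Fin m} :
    b x = b y ↔ circle (Q x) = circle (Q y) := by
  rw [h.circle_eq, h.circle_eq]
  refine ⟨fun hxy => by rw [hxy], fun hxy => ?_⟩
  by_contra hne
  exact h.distinct _ _ hne hxy

theorem Blocks.strictMono {m p p' : ℕ} {Q Q' : Fin m → ExpFactor} {q : Fin p → ExpFactor}
    {q' : Fin p' → ExpFactor} {b : Fin m → Fin p} {b' : Fin m → Fin p'} (h : Blocks Q q b)
    (h' : Blocks Q' q' b')
    (hc : ∀ x y, circle (Q x) = circle (Q y) ↔ circle (Q' x) = circle (Q' y)) :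
    StrictMono fun i => b' (Function.surjInv h.surj i) := by
  intro i j hij
  have hs : ∀ i, b (Function.surjInv h.surj i) = i := Function.surjInv_eq h.surj
  refine lt_of_le_of_ne (h'.mono (le_of_lt ?_)) fun heq => hij.ne ?_
  · by_contra hle
    have := h.mono (not_lt.1 hle)
    rw [hs, hs] at this
    exact absurd hij (not_lt.2 this)
  · rw [h'.eq_iff, ← hc, ← h.eq_iff, hs, hs] at heq
    exact heq

/-- The blocks are determined by the partition of the positions into circles. -/
theorem Blocks.unique {m p p' : ℕ} {Q Q' : Fin m → ExpFactor} {q : Fin p → ExpFactor}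
    {q' : Fin p' → ExpFactor} {b : Fin m → Fin p} {b' : Fin m → Fin p'} (h : Blocks Q q b)
    (h' : Blocks Q' q' b')
    (hc : ∀ x y, circle (Q x) = circle (Q y) ↔ circle (Q' x) = circle (Q' y)) :
    ∃ hp : p = p', ∀ x, b' x = Fin.cast hp (b x) := by
  have h1 := h.strictMono h' hc
  have hp : p = p' := by
    have h2 := h'.strictMono h fun x y => (hc x y).symm
    have e1 := Fintype.card_le_of_injective _ h1.injective
    have e2 := Fintype.card_le_of_injective _ h2.injective
    simp only [Fintype.card_fin] at e1 e2
    omega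
  subst hp
  refine ⟨rfl, fun x => ?_⟩
  have hid : h1.orderIsoOfSurjective _ (Finite.injective_iff_surjective.1 h1.injective) =
      OrderIso.refl _ := Subsingleton.elim _ _
  have h3 : b' (Function.surjInv h.surj (b x)) = b' x := by
    rw [h'.eq_iff, ← hc, ← h.eq_iff, Function.surjInv_eq h.surj]
  rw [← h3]
  exact DFunLike.congr_fun hid (b x)

namespace PointedType

variable (P : PointedType)

theorem exists_position : ∃ u : Fin P.fullList.length ≃
      {t // t ∈ places (fun i => sheets (P.q i)) P.mult},
    (∀ x, P.full x = placeValue P.q (u x).1) ∧ Monotone fun x => (u x).1.1 := by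
  obtain ⟨u, -, h1, h2⟩ := exists_position_equiv (nodup_places _ _) P.fullList_eq
  refine ⟨u, h1, fun x y hxy => ?_⟩
  rcases hxy.eq_or_lt with rfl | hlt
  · exact le_rfl
  · exact h2 _ (pairwise_places _ _) x y hlt

theorem exists_blocks : ∃ b, Blocks P.full P.q b := by
  obtain ⟨u, h1, h2⟩ := P.exists_position
  refine ⟨fun x => (u x).1.1, h2, fun i => ?_, fun x => ?_, P.distinct⟩
  · exact ⟨u.symm ⟨(i, 0, 0), mem_places.2 ⟨sheets_pos _, P.mult_pos i⟩⟩, by simp⟩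
  · rw [h1, placeValue, circle_twist]

theorem eq_of_circle_eq {P : PointedType} {i j : Fin P.p} (h : circle (P.q i) = circle (P.q j)) :
    i = j := by
  by_contra hne
  exact P.distinct i j hne h

theorem pairCount_full {x : ExpFactor} {i : Fin P.p} (h : circle x = circle (P.q i)) :
    pairCount P.full x = P.mult i := by
  classical
  obtain ⟨u, h1, -⟩ := P.exists_position
  obtain ⟨e, j, rfl⟩ := circle_eq_iff.1 h
  obtain ⟨e', a, ha, hea⟩ := exists_twist_eq e j (P.q i)
  rw [hea, ← Finset.card_range (P.mult i), pairCount, eq_comm]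
  refine Finset.card_bij (fun c hc => u.symm ⟨(i, a, c), mem_places.2 ⟨ha, Finset.mem_range.1 hc⟩⟩)
    ?_ ?_ ?_
  · intro c hc
    simp only [Finset.mem_filter, Finset.mem_univ, true_and, h1, Equiv.apply_symm_apply,
      placeValue]
    exact ⟨e', by simp [twist_twist]⟩
  · intro c hc c' hc' hcc
    simpa using hcc
  · intro y hy
    simp only [Finset.mem_filter, Finset.mem_univ, true_and, h1, placeValue] at hy
    obtain ⟨e'', he⟩ := hy
    obtain ⟨⟨⟨i', b, c⟩, hmem⟩, rfl⟩ := u.symm.surjective y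
    simp only [Equiv.apply_symm_apply] at he
    obtain rfl : i' = i := by
      refine eq_of_circle_eq ?_
      rw [← circle_twist 1 b, he, circle_twist, circle_twist]
    obtain ⟨hb, hc⟩ := mem_places.1 hmem
    rw [twist_twist, zero_add] at he
    obtain rfl := eq_of_twist_eq_twist hb ha he
    exact ⟨c, Finset.mem_range.2 hc, rfl⟩

theorem pairCount_full_eq_zero {x : ExpFactor} (h : ∀ i, circle x ≠ circle (P.q i)) :
    pairCount P.full x = 0 := by
  classical
  obtain ⟨b, hb⟩ := P.exists_blocks
  rw [pairCount, Finset.card_eq_zero, Finset.filter_eq_empty_iff]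
  rintro y - ⟨e, he⟩
  refine h (b y) ?_
  rw [← hb.circle_eq, he, circle_twist]

theorem halfMult_eq : P.halfMult = fun i => multBC P.full (P.q i) := by
  classical
  funext i
  rw [multBC_eq, P.pairCount_full rfl, halfMult]

end PointedType

/-! ### Admissible deformations preserve fission data -/

theorem multBC_congr {m : ℕ} {Q : Fin m → ExpFactor} (hQ : ∃ g : SignedPerm m, g.Generates Q)
    {x x' : ExpFactor} (h : circle x = circle x') : multBC Q x = multBC Q x' := by
  classical
  rw [multBC_eq, multBC_eq, pairCount_congr hQ h]
  simp only [isSpecial_congr (levelBC_congr h)]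

theorem Agree.multBC_eq {m : ℕ} {Q Q' : Fin m → ExpFactor} (h : Agree Q Q') {x : Fin m}
    (hx : slope (Q x) = slope (Q' x)) : multBC Q (Q x) = multBC Q' (Q' x) := by
  classical
  rw [Fission.multBC_eq, Fission.multBC_eq, h.pairCount_eq]
  simp only [isSpecial_congr (h.levelBC_eq hx)]

theorem datumBC_forget_eq {p p' : ℕ} {n : Fin p → ℚ} {q : Fin p → ExpFactor} {n' : Fin p' → ℚ}
    {q' : Fin p' → ExpFactor} (e : Fin p ≃ Fin p') (hn : ∀ i, n' (e i) = n i)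
    (hL : ∀ i, levelBC (q' (e i)) = levelBC (q i))
    (hf : ∀ i j, fissionExp (q' (e i)) (q' (e j)) = fissionExp (q i) (q j)) :
    (datumBC n q).forget = (datumBC n' q').forget :=
  Quotient.sound ⟨e, fun i => Prod.ext (hn i) (hL i), hf⟩

theorem AdmissibleBC.datumOfCircles_eq {m m' : ℕ} {Q : Fin m → ExpFactor}
    {Q' : Fin m' → ExpFactor} (h : AdmissibleBC Q Q') :
    datumOfCircles (activeCircles Q) (multBC Q) =
      datumOfCircles (activeCircles Q') (multBC Q') := by
  classical
  obtain rfl := h.1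
  obtain ⟨hA, hs⟩ := h.agree
  obtain ⟨g, hg, hg'⟩ := hA.generates
  have hex : ∀ C : activeCircles Q, ∃ x, mkCircle (Q x) = C.1 := by
    rintro ⟨C, hC⟩
    simpa [activeCircles] using hC
  choose x hx using hex
  have hmem : ∀ y, mkCircle (Q' y) ∈ activeCircles Q' := fun y =>
    Finset.mem_image_of_mem _ (Finset.mem_univ y)
  let φ : activeCircles Q → activeCircles Q' := fun C => ⟨mkCircle (Q' (x C)), hmem _⟩
  have hφ : Function.Bijective φ := by
    constructor
    · intro C D hCD
      have h1 : mkCircle (Q' (x C)) = mkCircle (Q' (x D)) := congrArg Subtype.val hCD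
      rw [mkCircle_eq_iff, ← hA.circle_eq_iff, ← mkCircle_eq_iff, hx, hx] at h1
      exact Subtype.ext h1
    · rintro ⟨D, hD⟩
      obtain ⟨y, -, rfl⟩ := Finset.mem_image.1 hD
      refine ⟨⟨mkCircle (Q y), Finset.mem_image_of_mem _ (Finset.mem_univ y)⟩, Subtype.ext ?_⟩
      rw [mkCircle_eq_iff, ← hA.circle_eq_iff, ← mkCircle_eq_iff, hx]
  have hc : ∀ C : activeCircles Q, circle C.1.rep = circle (Q (x C)) := by
    exact fun C => mkCircle_eq_iff.1 ((mkCircle_rep C.1).trans (hx C).symm)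
  have hc' : ∀ C : activeCircles Q, circle (φ C).1.rep = circle (Q' (x C)) :=
    fun C => circle_mkCircle_rep _
  refine datumBC_forget_eq (((activeCircles Q).equivFin.symm.trans
    (Equiv.ofBijective φ hφ)).trans (activeCircles Q').equivFin) (fun i => ?_) (fun i => ?_)
    fun i j => ?_ <;>
  simp only [Equiv.trans_apply, Equiv.symm_apply_apply, Equiv.ofBijective_apply]
  · rw [multBC_congr ⟨g, hg⟩ (hc _), multBC_congr ⟨g, hg'⟩ (hc' _), hA.multBC_eq (hs _)]
  · rw [levelBC_congr (hc _), levelBC_congr (hc' _), hA.levelBC_eq (hs _)]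
  · rw [fissionExp_congr (hc _) (hc _), fissionExp_congr (hc' _) (hc' _), hA.fissionExp_eq]

theorem AdmissibleBC.datumBC_eq {m m' p p' : ℕ} {Q : Fin m → ExpFactor}
    {Q' : Fin m' → ExpFactor} {q : Fin p → ExpFactor} {q' : Fin p' → ExpFactor} {b : Fin m → Fin p}
    {b' : Fin m' → Fin p'} (h : AdmissibleBC Q Q') (hb : Blocks Q q b) (hb' : Blocks Q' q' b') :
    datumBC (fun i => multBC Q (q i)) q = datumBC (fun i => multBC Q' (q' i)) q' := by
  obtain rfl := h.1
  obtain ⟨hA, hs⟩ := h.agree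
  obtain ⟨g, hg, hg'⟩ := hA.generates
  obtain ⟨rfl, hbb⟩ := hb.unique hb' fun x y => hA.circle_eq_iff
  have hex : ∀ i, ∃ x, circle (q i) = circle (Q x) ∧ circle (q' i) = circle (Q' x) := by
    intro i
    obtain ⟨x, rfl⟩ := hb.surj i
    exact ⟨x, (hb.circle_eq x).symm, by rw [hb'.circle_eq, hbb]; rfl⟩
  choose x hx hx' using hex
  rw [datumBC, datumBC]
  congr 1
  · funext i
    rw [multBC_congr ⟨g, hg⟩ (hx i), multBC_congr ⟨g, hg'⟩ (hx' i), levelBC_congr (hx i),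
      levelBC_congr (hx' i), hA.multBC_eq (hs _), hA.levelBC_eq (hs _)]
  · funext i j
    rw [fissionExp_congr (hx i) (hx j), fissionExp_congr (hx' i) (hx' j), hA.fissionExp_eq]

theorem slope_eq_of_fissionExp_lt {q q' : ExpFactor}
    (h : fissionExp q q' < max (slope q) (slope q')) : slope q = slope q' := by
  have key : ∀ {q q' : ExpFactor}, fissionExp q q' < slope q → slope q ≤ slope q' := by
    intro q q' h
    obtain ⟨e, j, hej⟩ := exists_slope_eq_fissionExp q q'
    have := slope_add_le (twist e j q - q') q'
    rw [sub_add_cancel, slope_twist, hej] at this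
    exact (le_max_iff.1 this).resolve_left (not_le.2 h)
  rcases lt_max_iff.1 h with h1 | h1
  · have := key h1
    exact le_antisymm this (key (fissionExp_comm q q' ▸ h1.trans_le this))
  · have := key (fissionExp_comm q q' ▸ h1)
    exact le_antisymm (key (h1.trans_le this)) this

theorem Agree.sheets_eq_one_iff {m : ℕ} {Q Q' : Fin m → ExpFactor} (h : Agree Q Q') (x : Fin m) :
    sheets (Q x) = 1 ↔ sheets (Q' x) = 1 := by
  obtain ⟨g, hg, hg'⟩ := h.generates
  have key : ∀ R : Fin m → ExpFactor, g.Generates R →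
      (sheets (R x) = 1 ↔ ∃ e : ℤˣ, R (g.perm x) = twist e 0 (R x)) := by
    intro R hR
    have h1 : galois 1 (R x) = twist (g.sign x) 0 (R (g.perm x)) := by
      rw [hR x, twist_zero_right]; rfl
    rw [Fission.sheets_eq_one_iff, h1]
    constructor
    · rintro ⟨e, he⟩
      refine ⟨g.sign x * e, ?_⟩
      have := congrArg (twist (g.sign x) 0) he
      rw [← twist_zero_right, twist_twist, twist_twist] at this
      simpa using this
    · rintro ⟨e, he⟩
      exact ⟨g.sign x * e, by rw [he, twist_twist, ← twist_zero_right]; simp⟩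
  rw [key Q hg, key Q' hg', h.exists_eq_twist_iff]

/-- A circle which occurs more than once, or which has several sheets, occupies several
positions. -/
theorem exists_ne_circle_eq {m : ℕ} {Q : Fin m → ExpFactor}
    (hQ : ∃ g : SignedPerm m, g.Generates Q) {x : Fin m}
    (h : ¬ (pairCount Q (Q x) = 1 ∧ sheets (Q x) = 1)) :
    ∃ y, x ≠ y ∧ circle (Q x) = circle (Q y) := by
  classical
  by_contra! hno
  refine h ⟨?_, ?_⟩
  · rw [pairCount, Finset.card_eq_one]
    refine ⟨x, ?_⟩
    ext y
    simp only [Finset.mem_filter, Finset.mem_univ, true_and, Finset.mem_singleton]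
    constructor
    · rintro ⟨e, he⟩
      by_contra hne
      exact hno y (Ne.symm hne) (by rw [he, circle_twist])
    · rintro rfl
      exact ⟨1, by simp⟩
  · obtain ⟨g, hg⟩ := hQ
    have h1 : galois 1 (Q x) = twist (g.sign x) 0 (Q (g.perm x)) := by
      rw [hg x, twist_zero_right]; rfl
    have h2 : x = g.perm x := by
      by_contra hne
      refine hno _ hne ?_
      rw [← circle_twist 1 1, twist_one_left, h1, circle_twist]
    rw [sheets_eq_one_iff]
    exact ⟨g.sign x, by rw [h1, ← h2, twist_zero_right]⟩

theorem AdmissibleD.datumD_eq {m m' p p' : ℕ} {Q : Fin m → ExpFactor}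
    {Q' : Fin m' → ExpFactor} {q : Fin p → ExpFactor} {q' : Fin p' → ExpFactor} {b : Fin m → Fin p}
    {b' : Fin m' → Fin p'} {μ : Fin p → ℕ} {μ' : Fin p' → ℕ} {ε : Fin p → ℤˣ} {ε' : Fin p' → ℤˣ}
    (h : AdmissibleD Q Q') (hb : Blocks Q q b) (hb' : Blocks Q' q' b')
    (hμ : ∀ i, pairCount Q (q i) = μ i) (hμ' : ∀ i, pairCount Q' (q' i) = μ' i)
    (hμ0 : ∀ i, 0 < μ i) (hμ0' : ∀ i, 0 < μ' i)
    (hε : ∃ hp : p = p', ∀ i, ε i = ε' (Fin.cast hp i)) :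
    datumD μ q ε = datumD μ' q' ε' := by
  classical
  obtain rfl := h.1
  have hA := h.agree
  obtain ⟨g, hg, hg'⟩ := hA.generates
  obtain ⟨rfl, hbb⟩ := hb.unique hb' fun x y => hA.circle_eq_iff
  obtain ⟨hp, hε⟩ := hε
  have hex : ∀ i, ∃ x, circle (q i) = circle (Q x) ∧ circle (q' i) = circle (Q' x) := by
    intro i
    obtain ⟨x, rfl⟩ := hb.surj i
    exact ⟨x, (hb.circle_eq x).symm, by rw [hb'.circle_eq, hbb]; rfl⟩
  choose x hx hx' using hex
  have hμμ : ∀ i, pairCount Q (Q (x i)) = μ i := fun i => by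
    rw [← hμ, pairCount_congr ⟨g, hg⟩ (hx i)]
  have hμe : μ = μ' := by
    funext i
    rw [← hμμ, ← hμ', hA.pairCount_eq, pairCount_congr ⟨g, hg'⟩ (hx' i)]
  have hf : ∀ i j, fissionExp (q i) (q j) = fissionExp (q' i) (q' j) := fun i j => by
    rw [fissionExp_congr (hx i) (hx j), fissionExp_congr (hx' i) (hx' j), hA.fissionExp_eq]
  have hmax : ∀ i j, j ≠ i →
      max (slope (q i)) (slope (q j)) = max (slope (q' i)) (slope (q' j)) := by
    intro i j hij
    rw [slope_congr (hx i), slope_congr (hx j), slope_congr (hx' i), slope_congr (hx' j)]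
    refine hA.max_slope_eq fun hxx => hij ?_
    by_contra hne
    exact hb.distinct j i hne (by rw [hx, hx, hxx])
  have hsh : ∀ i, sheets (q i) = 1 ↔ sheets (q' i) = 1 := fun i => by
    rw [sheets_congr (levelBC_congr (hx i)), sheets_congr (levelBC_congr (hx' i)),
      hA.sheets_eq_one_iff]
  have hlev : ∀ i, slope (q i) = slope (q' i) → levelBC (q i) = levelBC (q' i) := by
    intro i hs
    rw [slope_congr (hx i), slope_congr (hx' i)] at hs
    rw [levelBC_congr (hx i), levelBC_congr (hx' i), hA.levelBC_eq hs]
  subst hμe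
  have hL : ∀ i, levelDIn μ q i = levelDIn μ q' i := by
    intro i
    rw [levelDIn_eq q (hμ0 i), levelDIn_eq q' (hμ0 i)]
    by_cases h1 : μ i = 1 ∧ sheets (q i) = 1
    · rw [if_pos h1, if_pos (show _ ∧ sheets (q' i) = 1 from ⟨h1.1, (hsh i).1 h1.2⟩)]
      by_cases h2 : ∀ j, j ≠ i → max (slope (q i)) (slope (q j)) ≤ fissionExp (q i) (q j)
      · rw [if_pos h2, if_pos fun j hj => by rw [← hmax i j hj, ← hf]; exact h2 j hj]
      · rw [if_neg h2, if_neg fun h3 => h2 fun j hj => by rw [hmax i j hj, hf]; exact h3 j hj]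
        -- a nonvanishing common part with `q j` makes `slope (q i)` visible
        push Not at h2
        obtain ⟨j, hj, hlt⟩ := h2
        have e1 := slope_eq_of_fissionExp_lt hlt
        have e2 := slope_eq_of_fissionExp_lt (hf i j ▸ hmax i j hj ▸ hlt)
        have e3 := hmax i j hj
        rw [← e1, ← e2, max_self, max_self] at e3
        rw [hlev i e3]
    · rw [if_neg h1, if_neg (show ¬(_ ∧ sheets (q' i) = 1) from
        fun h2 => h1 ⟨h2.1, (hsh i).2 h2.2⟩)]
      obtain ⟨y, hne, hc⟩ := exists_ne_circle_eq ⟨g, hg⟩ (x := x i) (by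
        rwa [hμμ, ← sheets_congr (levelBC_congr (hx i))])
      have hs : slope (q i) = slope (q' i) := by
        rw [slope_congr (hx i), slope_congr (hx' i), hA.slope_eq_of_circle_eq hne hc]
      simp only [hlev i hs, ← slope_eq_zero_iff, hs]
  rw [datumD, datumD]
  congr 1
  · funext i
    rw [hL, hε]; rfl
  · funext i j
    exact hf i j

/-! ### Fission data determine admissible deformations -/

/-- The place of the Galois conjugate of the exponential factor at a place. -/
def nextPlace {p : ℕ} (N : Fin p → ℕ) (t : Fin p × ℕ × ℕ) : Fin p × ℕ × ℕ :=
  (t.1, if t.2.1 + 1 = N t.1 then 0 else t.2.1 + 1, t.2.2)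

theorem nextPlace_mem {p : ℕ} {N μ : Fin p → ℕ} {t : Fin p × ℕ × ℕ} (ht : t ∈ places N μ) :
    nextPlace N t ∈ places N μ := by
  rw [mem_places] at ht ⊢
  refine ⟨?_, ht.2⟩
  simp only [nextPlace]
  split_ifs <;> omega

theorem nextPlace_injective {p : ℕ} {N : Fin p → ℕ} {s t : Fin p × ℕ × ℕ}
    (h : nextPlace N s = nextPlace N t) : s = t := by
  obtain ⟨i, a, c⟩ := s
  obtain ⟨j, b, d⟩ := t
  simp only [nextPlace, Prod.mk.injEq] at h ⊢
  obtain ⟨rfl, h, rfl⟩ := h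
  refine ⟨rfl, ?_, rfl⟩
  split_ifs at h <;> omega

/-- The sign of the Galois action at a place, when the `c`-th copy of the `i`-th circle is given
the sign `δ i c`. -/
def placeSign {p : ℕ} (N : Fin p → ℕ) (δ : Fin p → ℕ → ℤˣ) (t : Fin p × ℕ × ℕ) : ℤˣ :=
  if t.2.1 + 1 = N t.1 then δ t.1 t.2.2 else 1

theorem galois_placeValue {p : ℕ} {N μ : Fin p → ℕ} {q : Fin p → ExpFactor}
    {δ : Fin p → ℕ → ℤˣ} (hδ : ∀ i c, c < μ i → galois (N i) (q i) = (δ i c : ℤ) • q i)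
    {t : Fin p × ℕ × ℕ} (ht : t ∈ places N μ) :
    galois 1 (placeValue q t) = (placeSign N δ t : ℤ) • placeValue q (nextPlace N t) := by
  obtain ⟨i, a, c⟩ := t
  obtain ⟨ha, hc⟩ := mem_places.1 ht
  simp only [placeValue, nextPlace, placeSign] at ha hc ⊢
  rw [← twist_one_left, twist_twist, ← twist_zero_right, twist_twist]
  split_ifs with h
  · have := hδ i c hc
    rw [← twist_one_left, ← twist_zero_right, ← h] at this
    simpa [add_comm] using this
  · simp [add_comm]

theorem prod_placeSign {p : ℕ} {N μ : Fin p → ℕ} (hN : ∀ i, 0 < N i) (δ : Fin p → ℕ → ℤˣ) :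
    ∏ t : {t // t ∈ places N μ}, placeSign N δ t.1 = ∏ i, ∏ c ∈ Finset.range (μ i), δ i c := by
  classical
  have h1 : ∀ i, ∏ c ∈ Finset.range (μ i), δ i c =
      ∏ x ∈ Finset.range (N i) ×ˢ Finset.range (μ i), placeSign N δ (i, x.1, x.2) := by
    intro i
    rw [Finset.prod_product_right]
    refine Finset.prod_congr rfl fun c _ => ?_
    have hlast : N i - 1 + 1 = N i := Nat.sub_add_cancel (hN i)
    rw [Finset.prod_eq_single (N i - 1)]
    · simp [placeSign, hlast]
    · intro a _ ha
      have : a + 1 ≠ N i := by omega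
      simp [placeSign, this]
    · intro h
      exact absurd (Finset.mem_range.2 (by omega)) h
  simp only [h1]
  rw [Finset.prod_sigma']
  refine Finset.prod_bij (fun t _ => ⟨t.1.1, t.1.2⟩) ?_ ?_ ?_ ?_
  · rintro ⟨t, ht⟩ -
    simpa using mem_places.1 ht
  · rintro ⟨⟨i, x⟩, hs⟩ - ⟨⟨j, y⟩, ht⟩ - h
    simp only [Sigma.mk.injEq] at h
    obtain ⟨rfl, h⟩ := h
    simp [eq_of_heq h]
  · rintro ⟨i, x⟩ hx
    exact ⟨⟨(i, x), mem_places.2 (by simpa using hx)⟩, Finset.mem_univ _, rfl⟩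
  · intros
    rfl

/-- Two families with the same numbers of sheets, the same multiplicities and the same mutual
slopes give rise to full types whose Galois-orbits have a common generator, which moves each
conjugate to the next one. -/
theorem exists_generator {p : ℕ} {N μ : Fin p → ℕ} {q q' : Fin p → ExpFactor}
    {δ : Fin p → ℕ → ℤˣ} (hN : ∀ i, 0 < N i)
    (hδ : ∀ i c, c < μ i → galois (N i) (q i) = (δ i c : ℤ) • q i)
    (hδ' : ∀ i c, c < μ i → galois (N i) (q' i) = (δ i c : ℤ) • q' i)
    (hself : ∀ i, (N i = 1 ∧ μ i = 1) ∨
      ∀ e j, slope (twist e j (q i) - q i) = slope (twist e j (q' i) - q' i))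
    (hmut : ∀ i i', i ≠ i' → ∀ e j,
      slope (twist e j (q i) - q i') = slope (twist e j (q' i) - q' i'))
    {l l' : List ExpFactor} (hl : l = (places N μ).map (placeValue q))
    (hl' : l' = (places N μ).map (placeValue q')) :
    ∃ h : l.length = l'.length,
      (∃ g : SignedPerm l.length, ∏ x, g.sign x = ∏ i, ∏ c ∈ Finset.range (μ i), δ i c ∧
        g.Generates l.get ∧ g.Generates fun x => l'.get (Fin.cast h x)) ∧
      (∀ x y, x ≠ y →
        slope (l.get x + l.get y) = slope (l'.get (Fin.cast h x) + l'.get (Fin.cast h y)) ∧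
        slope (l.get x - l.get y) = slope (l'.get (Fin.cast h x) - l'.get (Fin.cast h y))) ∧
      ∀ x, ∃ i, circle (l.get x) = circle (q i) ∧
        circle (l'.get (Fin.cast h x)) = circle (q' i) := by
  obtain ⟨u, hu, hQ, -⟩ := exists_position_equiv (nodup_places N μ) hl
  obtain ⟨u', hu', hQ', -⟩ := exists_position_equiv (nodup_places N μ) hl'
  have h : l.length = l'.length := by rw [hl, hl', List.length_map, List.length_map]
  have huu : ∀ x, (u' (Fin.cast h x)).1 = (u x).1 := by
    intro x
    have := hu' (Fin.cast h x)
    rw [Fin.val_cast, hu x, Option.some_inj] at this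
    exact this.symm
  have hQ' : ∀ x, l'.get (Fin.cast h x) = placeValue q' (u x).1 := fun x => by rw [hQ', huu]
  refine ⟨h, ?_, ?_, ?_⟩
  · let f : {t // t ∈ places N μ} → {t // t ∈ places N μ} :=
      fun t => ⟨nextPlace N t.1, nextPlace_mem t.2⟩
    have hf : Function.Bijective f := Finite.injective_iff_bijective.1 fun s t hst =>
      Subtype.ext (nextPlace_injective (congrArg Subtype.val hst))
    let g : SignedPerm l.length :=
      ⟨(u.trans (Equiv.ofBijective f hf)).trans u.symm, fun x => placeSign N δ (u x).1⟩
    have hg : ∀ x, (u (g.perm x)).1 = nextPlace N (u x).1 := by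
      intro x
      simp [g, f]
    refine ⟨g, ?_, fun x => ?_, fun x => ?_⟩
    · rw [← prod_placeSign hN]
      exact Equiv.prod_comp u fun t => placeSign N δ t.1
    · simp only [SignedPerm.act, hQ, hg]
      exact galois_placeValue hδ (u x).2
    · simp only [SignedPerm.act, hQ', hg]
      exact galois_placeValue hδ' (u x).2
  · intro x y hxy
    have key : ∀ e, slope (twist e 0 (l.get x) - l.get y) =
        slope (twist e 0 (l'.get (Fin.cast h x)) - l'.get (Fin.cast h y)) := by
      intro e
      rw [hQ, hQ, hQ', hQ', placeValue, placeValue, placeValue, placeValue, twist_twist,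
        twist_twist, slope_twist_sub_twist, slope_twist_sub_twist]
      by_cases hi : (u x).1.1 = (u y).1.1
      · rw [← hi]
        refine (hself (u x).1.1).elim (fun h1 => ?_) fun h1 => h1 _ _
        -- a circle with a single place cannot contain two positions
        refine absurd (u.injective (Subtype.ext ?_)) hxy
        have hx := mem_places.1 (u x).2
        have hy := mem_places.1 (u y).2
        rw [← hi, h1.1, h1.2] at hy
        rw [h1.1, h1.2] at hx
        exact Prod.ext hi (Prod.ext (by omega) (by omega))
      · exact hmut _ _ hi _ _
    constructor
    · rw [slope_add_eq_twist, key, ← slope_add_eq_twist]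
    · simpa using key 1
  · intro x
    exact ⟨(u x).1.1, by rw [hQ, placeValue, circle_twist], by rw [hQ', placeValue, circle_twist]⟩

open scoped Classical in
/-- The signs for `exists_generator`: the Galois action changes the sign after one turn around a
special circle, and the sign of a tame circle is put on its first copy. -/
def copySign (ε : ℤˣ) (q : ExpFactor) (c : ℕ) : ℤˣ :=
  if IsSpecial q then -1 else if c = 0 then ε else 1

theorem prod_copySign {ε : ℤˣ} {q : ExpFactor} {μ : ℕ} (hμ : 0 < μ)
    (hs : IsSpecial q → ε = (-1) ^ μ) : ∏ c ∈ Finset.range μ, copySign ε q c = ε := by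
  by_cases h : IsSpecial q
  · simp [copySign, h, hs h]
  · simp [copySign, h, hμ]

theorem galois_sheets_copySign {ε : ℤˣ} {q : ExpFactor} (c : ℕ)
    (hn : q ≠ 0 → ¬ IsSpecial q → ε = 1) :
    galois (sheets q) q = (copySign ε q c : ℤ) • q := by
  refine galois_sheets fun h0 => ?_
  by_cases h : IsSpecial q
  · simp [copySign, h]
  · simp [copySign, h, hn h0 h]

theorem copySign_congr (ε : ℤˣ) {q q' : ExpFactor} (h : levelBC q = levelBC q') (c : ℕ) :
    copySign ε q c = copySign ε q' c := by
  have hs := isSpecial_congr h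
  by_cases h1 : IsSpecial q
  · simp [copySign, h1, hs.1 h1]
  · simp [copySign, h1, mt hs.2 h1]

theorem admissibleBC_of_levelBC_eq {p : ℕ} {μ : Fin p → ℕ} {q q' : Fin p → ExpFactor}
    (hc : ∀ i j, i ≠ j → slope (q i - q j) ≤ fissionExp (q i) (q j))
    (hc' : ∀ i j, i ≠ j → slope (q' i - q' j) ≤ fissionExp (q' i) (q' j))
    (hL : ∀ i, levelBC (q i) = levelBC (q' i))
    (hf : ∀ i j, fissionExp (q i) (q j) = fissionExp (q' i) (q' j))
    {l l' : List ExpFactor} (hl : l = (places (fun i => sheets (q i)) μ).map (placeValue q))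
    (hl' : l' = (places (fun i => sheets (q' i)) μ).map (placeValue q')) :
    AdmissibleBC l.get l'.get := by
  have hN : ∀ i, sheets (q i) = sheets (q' i) := fun i => sheets_congr (hL i)
  simp only [← hN] at hl'
  obtain ⟨h, ⟨g, -, hg⟩, hs, hx⟩ := exists_generator (δ := fun i => copySign 1 (q i))
    (fun i => sheets_pos (q i)) (fun i c _ => galois_sheets_copySign c fun _ _ => rfl)
    (fun i c _ => by
      rw [copySign_congr 1 (hL i), hN]
      exact galois_sheets_copySign c fun _ _ => rfl)
    (fun i => Or.inr (levelBC_eq_iff.1 (hL i)))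
    (fun i i' hii e j => by
      rw [slope_twist_sub_of_compatible (hc i i' hii), slope_twist_sub_of_compatible (hc' i i' hii),
        levelBC_eq_iff.1 (hL i), hf]) hl hl'
  refine ⟨h, ⟨g, hg⟩, hs, fun x => ?_⟩
  obtain ⟨i, hi, hi'⟩ := hx x
  rw [slope_congr hi, slope_congr hi', slope_eq_of_levelBC_eq (hL i)]

/-- Equal enhanced level data are equal `BC`-level data, except for simple circles with one sheet
and vanishing common parts. -/
theorem levelBC_eq_or_of_levelDIn_eq {p : ℕ} {μ : Fin p → ℕ} {q q' : Fin p → ExpFactor}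
    {i : Fin p} (hμ : 0 < μ i) (h : levelDIn μ q i = levelDIn μ q' i) :
    levelBC (q i) = levelBC (q' i) ∨
      μ i = 1 ∧ (sheets (q i) = 1 ∧ ∀ j, j ≠ i → slope (q i) ≤ fissionExp (q i) (q j)) ∧
        (sheets (q' i) = 1 ∧ ∀ j, j ≠ i → slope (q' i) ≤ fissionExp (q' i) (q' j)) := by
  rw [levelDIn_eq q hμ, levelDIn_eq q' hμ] at h
  split_ifs at h with h1 h2 h3 h4 h3 h4 h3 h4 h5 h2 h3 h4 h5 h3
  all_goals first
    | exact Or.inr ⟨h1.1, ⟨h1.2, fun j hj => (le_max_left _ _).trans (h2 j hj)⟩,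
        ⟨h3.2, fun j hj => (le_max_left _ _).trans (h4 j hj)⟩⟩
    | exact Or.inl (LevelD.levels.inj h)
    | simp_all

theorem admissibleD_of_levelDIn_eq {p : ℕ} {μ : Fin p → ℕ} {q q' : Fin p → ExpFactor}
    {ε : Fin p → ℤˣ} (hμ : ∀ i, 0 < μ i) (hε : ∏ i, ε i = 1)
    (hs : ∀ i, IsSpecial (q i) → ε i = (-1) ^ μ i)
    (hs' : ∀ i, IsSpecial (q' i) → ε i = (-1) ^ μ i)
    (hn : ∀ i, q i ≠ 0 → ¬ IsSpecial (q i) → ε i = 1)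
    (hn' : ∀ i, q' i ≠ 0 → ¬ IsSpecial (q' i) → ε i = 1)
    (hc : ∀ i j, i ≠ j → slope (q i - q j) ≤ fissionExp (q i) (q j))
    (hc' : ∀ i j, i ≠ j → slope (q' i - q' j) ≤ fissionExp (q' i) (q' j))
    (hL : ∀ i, levelDIn μ q i = levelDIn μ q' i)
    (hf : ∀ i j, fissionExp (q i) (q j) = fissionExp (q' i) (q' j))
    {l l' : List ExpFactor} (hl : l = (places (fun i => sheets (q i)) μ).map (placeValue q))
    (hl' : l' = (places (fun i => sheets (q' i)) μ).map (placeValue q')) :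
    AdmissibleD l.get l'.get := by
  have hcase := fun i => levelBC_eq_or_of_levelDIn_eq (hμ i) (hL i)
  have hN : ∀ i, sheets (q i) = sheets (q' i) := fun i =>
    (hcase i).elim sheets_congr fun h => h.2.1.1.trans h.2.2.1.symm
  simp only [← hN] at hl'
  obtain ⟨h, ⟨g, hgD, hg⟩, hsl, -⟩ := exists_generator (δ := fun i => copySign (ε i) (q i))
    (fun i => sheets_pos (q i)) (fun i c _ => galois_sheets_copySign c (hn i))
    (fun i c hic => by
      rcases hcase i with hi | ⟨hi, -⟩
      · rw [copySign_congr (ε i) hi, hN]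
        exact galois_sheets_copySign c (hn' i)
      · -- a simple circle: the sign is `ε i`, for `q i` as for `q' i`
        obtain rfl : c = 0 := by omega
        have key : ∀ x, (IsSpecial x → ε i = (-1) ^ μ i) → copySign (ε i) x 0 = ε i := by
          intro x hx
          have := prod_copySign (hμ i) hx
          rwa [hi, Finset.prod_range_one] at this
        rw [key _ (hs i), ← key _ (hs' i), hN]
        exact galois_sheets_copySign 0 (hn' i))
    (fun i => (hcase i).elim (fun hi => Or.inr (levelBC_eq_iff.1 hi))
      fun hi => Or.inl ⟨hi.2.1.1, hi.1⟩)
    (fun i i' hii e j => by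
      rw [slope_twist_sub_of_compatible (hc i i' hii), slope_twist_sub_of_compatible (hc' i i' hii)]
      rcases hcase i with hi | ⟨-, ⟨-, hi⟩, ⟨-, hi'⟩⟩
      · rw [levelBC_eq_iff.1 hi, hf]
      · have key : ∀ x, slope (twist e j x - x) ≤ slope x := fun x => by
          simpa using slope_sub_le (twist e j x) x
        rw [max_eq_right ((key _).trans (hi i' hii.symm)),
          max_eq_right ((key _).trans (hi' i' hii.symm)), hf]) hl hl'
  refine ⟨h, ⟨g, ?_, hg⟩, hsl⟩
  rw [SignedPerm.IsTypeD, hgD, ← hε]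
  exact Finset.prod_congr rfl fun i _ => prod_copySign (hμ i) (hs i)

/-! ### Pointed types -/

theorem PointedType.admissibleBC_iff {P P' : PointedType} (hP : P.Compatible)
    (hP' : P'.Compatible) :
    AdmissibleBC P.full P'.full ↔ P.labelledDatumBC = P'.labelledDatumBC := by
  classical
  constructor
  · intro h
    obtain ⟨b, hb⟩ := P.exists_blocks
    obtain ⟨b', hb'⟩ := P'.exists_blocks
    rw [labelledDatumBC, labelledDatumBC, halfMult_eq, halfMult_eq]
    exact h.datumBC_eq hb hb'
  · intro h
    rw [compatible_iff] at hP hP'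
    have hl := P.fullList_eq
    have hl' := P'.fullList_eq
    unfold full
    obtain ⟨p, p_pos, μ, hμ, q, hd⟩ := P
    obtain ⟨p', p_pos', μ', hμ', q', hd'⟩ := P'
    simp only [labelledDatumBC, datumBC, LabelledDatum.mk.injEq] at h hP hP' hl hl'
    obtain ⟨rfl, h1, h2⟩ := h
    have h1 := fun i => congrFun (eq_of_heq h1) i
    have h2 := fun i j => congrFun₂ (eq_of_heq h2) i j
    simp only [Prod.mk.injEq, halfMult] at h1
    have hL : ∀ i, levelBC (q i) = levelBC (q' i) := fun i => (h1 i).2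
    obtain rfl : μ = μ' := by
      funext i
      have := (h1 i).1
      simp only [isSpecial_congr (hL i)] at this
      split_ifs at this
      · have h3 := (div_left_inj' (two_ne_zero' ℚ)).1 this
        exact_mod_cast h3
      · exact_mod_cast this
    exact admissibleBC_of_levelBC_eq hP hP' hL h2 hl hl'

theorem EnhancedPointedType.Admissible.labelledDatum_eq {P P' : EnhancedPointedType}
    (h : P.Admissible P') : P.labelledDatum = P'.labelledDatum := by
  obtain ⟨b, hb⟩ := P.toPointedType.exists_blocks
  obtain ⟨b', hb'⟩ := P'.toPointedType.exists_blocks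
  exact h.2.datumD_eq hb hb' (fun i => P.pairCount_full rfl) (fun i => P'.pairCount_full rfl)
    P.mult_pos P'.mult_pos h.1

theorem EnhancedPointedType.admissible_iff {P P' : EnhancedPointedType} (hI : P.IsIrregularType)
    (hP : P.Compatible) (hP' : P'.Compatible) :
    P.Admissible P' ↔ P.labelledDatum = P'.labelledDatum := by
  refine ⟨fun h => h.labelledDatum_eq, fun h => ?_⟩
  rw [compatible_iff] at hP hP'
  have hl := P.toPointedType.fullList_eq
  have hl' := P'.toPointedType.fullList_eq
  obtain ⟨⟨p, p_pos, μ, hμ, q, hd⟩, ε, hs, hn⟩ := P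
  obtain ⟨⟨p', p_pos', μ', hμ', q', hd'⟩, ε', hs', hn'⟩ := P'
  simp only [labelledDatum, datumD, LabelledDatum.mk.injEq] at h hP hP' hl hl'
  obtain ⟨rfl, h1, h2⟩ := h
  have h1 := fun i => congrFun (eq_of_heq h1) i
  have h2 := fun i j => congrFun₂ (eq_of_heq h2) i j
  simp only [Prod.mk.injEq] at h1
  obtain rfl : μ = μ' := funext fun i => (h1 i).1
  obtain rfl : ε = ε' := funext fun i => (h1 i).2.2
  exact ⟨⟨rfl, fun _ => rfl⟩, admissibleD_of_levelDIn_eq hμ hI hs hs' hn hn' hP hP'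
    (fun i => (h1 i).2.1) h2 hl hl'⟩

/-! ### Irregular classes -/

theorem exists_compatible_rep {p : ℕ} (C : Fin p → StokesCircle) :
    ∃ q : Fin p → ExpFactor, (∀ i, circle (q i) = (C i).1) ∧
      ∀ i j, i ≠ j → slope (q i - q j) ≤ fissionExp (q i) (q j) := by
  obtain ⟨q, hq, hc⟩ := exists_compatible (fun i => (C i).rep) Finset.univ
  refine ⟨q, fun i => (hq i).trans (circle_rep _), fun i j _ => ?_⟩
  rw [fissionExp_congr (hq i) (hq j)]
  exact hc i (Finset.mem_univ i) j (Finset.mem_univ j)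

/-- Tuples in which every exponential factor occurs equally often up to sign are in the same orbit
of the Weyl group of type `BC`. -/
theorem exists_act_eq_of_pairCount_eq {l m : ℕ} {R : Fin l → ExpFactor} {Q : Fin m → ExpFactor}
    (h : ∀ x, pairCount R x = pairCount Q x) :
    ∃ hl : l = m, ∃ g : SignedPerm m, (fun i => R (Fin.cast hl.symm i)) = g.act Q := by
  classical
  let φ : ExpFactor → Set ExpFactor := fun x => {v | ∃ e : ℤˣ, v = twist e 0 x}
  have hφ : ∀ x y, φ x = φ y ↔ ∃ e : ℤˣ, x = twist e 0 y := by
    intro x y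
    constructor
    · intro h
      have : x ∈ φ x := ⟨1, by simp⟩
      rwa [h] at this
    · rintro ⟨e, rfl⟩
      ext v
      constructor
      · rintro ⟨e', rfl⟩
        exact ⟨e' * e, by simp [twist_twist]⟩
      · rintro ⟨e', rfl⟩
        exact ⟨e' * e, by simp [twist_twist, mul_assoc]⟩
  have hfib : ∀ c, Nonempty ({y // φ (R y) = c} ≃ {y // φ (Q y) = c}) := by
    intro c
    rw [← Fintype.card_eq]
    by_cases hc : ∃ x, φ x = c
    · obtain ⟨x, rfl⟩ := hc
      have := h x
      simp only [hφ]
      rwa [Fintype.card_subtype, Fintype.card_subtype]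
    · have h1 : IsEmpty {y // φ (R y) = c} := ⟨fun y => hc ⟨_, y.2⟩⟩
      have h2 : IsEmpty {y // φ (Q y) = c} := ⟨fun y => hc ⟨_, y.2⟩⟩
      rw [Fintype.card_eq_zero, Fintype.card_eq_zero]
  let F := fun c => (hfib c).some
  let π : Fin l ≃ Fin m := (Equiv.sigmaFiberEquiv fun y => φ (R y)).symm.trans
    ((Equiv.sigmaCongrRight F).trans (Equiv.sigmaFiberEquiv fun y => φ (Q y)))
  have hπ : ∀ y, ∃ e : ℤˣ, R y = twist e 0 (Q (π y)) := by
    intro y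
    rw [← hφ]
    exact (F (φ (R y)) ⟨y, rfl⟩).2.symm
  obtain rfl : l = m := by simpa using Fintype.card_congr π
  choose e he using hπ
  refine ⟨rfl, ⟨π, e⟩, ?_⟩
  funext y
  rw [SignedPerm.act, ← twist_zero_right]
  exact he y

theorem ClassBC.admissible_of_pairCount_eq {l l' m m' : ℕ} {R : Fin l → ExpFactor}
    {R' : Fin l' → ExpFactor} (h : AdmissibleBC R R') {Q : FullTypeBC m} {Q' : FullTypeBC m'}
    (hQ : ∀ x, pairCount R x = pairCount Q.1 x) (hQ' : ∀ x, pairCount R' x = pairCount Q'.1 x) :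
    ClassBC.Admissible (Quotient.mk (bcSetoid m) Q) (Quotient.mk (bcSetoid m') Q') := by
  obtain ⟨rfl, g, hg⟩ := exists_act_eq_of_pairCount_eq hQ
  obtain ⟨rfl, g', hg'⟩ := exists_act_eq_of_pairCount_eq hQ'
  obtain rfl := h.1
  obtain ⟨γ, hγ, hγ'⟩ := h.agree.1.generates
  exact ⟨⟨R, γ, hγ⟩, ⟨R', γ, hγ'⟩, Quotient.sound (Setoid.symm ⟨g, hg⟩),
    Quotient.sound (Setoid.symm ⟨g', hg'⟩), h⟩

theorem pairCount_pos {m : ℕ} (Q : Fin m → ExpFactor) (x : Fin m) : 0 < pairCount Q (Q x) := by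
  classical
  exact Finset.card_pos.2 ⟨x, by simpa using ⟨1, by simp⟩⟩

/-- Every irregular class is represented by a pointed type, with any given choice of points and
order of the active circles. -/
theorem exists_pointedType {m p : ℕ} (hp : 0 < p) {Q : Fin m → ExpFactor}
    (hQ : ∃ g : SignedPerm m, g.Generates Q) (u : Fin p ≃ activeCircles Q)
    {q : Fin p → ExpFactor} (hq : ∀ i, circle (q i) = (u i).1.1) :
    ∃ P : PointedType, P.labelledDatumBC = datumBC (fun i => multBC Q (q i)) q ∧
      ((∀ i j, i ≠ j → slope (q i - q j) ≤ fissionExp (q i) (q j)) → P.Compatible) ∧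
      ∀ x, pairCount P.full x = pairCount Q x := by
  classical
  have hmk : ∀ i, mkCircle (q i) = (u i).1 := fun i => Subtype.ext (hq i)
  let P : PointedType :=
    { p := p
      p_pos := hp
      mult := fun i => pairCount Q (q i)
      mult_pos := fun i => by
        obtain ⟨y, -, hy⟩ := Finset.mem_image.1 (u i).2
        rw [← hmk, mkCircle_eq_iff] at hy
        rw [← pairCount_congr hQ hy]
        exact pairCount_pos Q y
      q := q
      distinct := fun i j hij h => hij <| u.injective <| Subtype.ext <| by
        rw [← hmk, ← hmk, mkCircle_eq_iff, h] }
  refine ⟨P, ?_, fun hc => compatible_iff.2 hc, fun x => ?_⟩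
  · rw [PointedType.labelledDatumBC]
    refine congrArg (datumBC · q) (funext fun i => ?_)
    rw [multBC_eq]
    rfl
  · by_cases hx : ∃ i, circle x = circle (q i)
    · obtain ⟨i, hi⟩ := hx
      rw [P.pairCount_full (i := i) hi, pairCount_congr hQ hi]
    · rw [P.pairCount_full_eq_zero fun i hi => hx ⟨i, hi⟩, eq_comm, pairCount,
        Finset.card_eq_zero, Finset.filter_eq_empty_iff]
      rintro y - ⟨e, he⟩
      obtain ⟨i, hi⟩ := u.surjective ⟨mkCircle (Q y), Finset.mem_image_of_mem _ (Finset.mem_univ y)⟩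
      refine hx ⟨i, ?_⟩
      rw [hq, hi, ← circle_twist e 0 x, ← he]
      rfl

theorem ClassBC.admissible_iff {m m' : ℕ} (hm : 1 ≤ m) (Θ : ClassBC m) (Θ' : ClassBC m') :
    Θ.Admissible Θ' ↔ Θ.fissionDatum = Θ'.fissionDatum := by
  classical
  constructor
  · rintro ⟨Q, Q', rfl, rfl, h⟩
    exact h.datumOfCircles_eq
  · induction Θ using Quotient.inductionOn with | _ Q
    induction Θ' using Quotient.inductionOn with | _ Q'
    intro h
    obtain ⟨e, h1, h2⟩ : ∃ e : Fin (activeCircles Q.1).card ≃ Fin (activeCircles Q'.1).card, _ :=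
      Quotient.exact h
    have hp : 0 < (activeCircles Q.1).card :=
      Finset.card_pos.2 ⟨_, Finset.mem_image_of_mem _ (Finset.mem_univ ⟨0, hm⟩)⟩
    obtain ⟨q, hq, hc⟩ := exists_compatible_rep fun i => ((activeCircles Q.1).equivFin.symm i).1
    obtain ⟨q', hq', hc'⟩ := exists_compatible_rep
      fun i => ((activeCircles Q'.1).equivFin.symm (e i)).1
    obtain ⟨P, hP, hPc, hPQ⟩ := exists_pointedType hp Q.2 (activeCircles Q.1).equivFin.symm hq
    obtain ⟨P', hP', hPc', hPQ'⟩ := exists_pointedType hp Q'.2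
      (e.trans (activeCircles Q'.1).equivFin.symm) hq'
    refine admissible_of_pairCount_eq ?_ hPQ hPQ'
    rw [PointedType.admissibleBC_iff (hPc hc) (hPc' hc'), hP, hP', datumBC, datumBC]
    have hr : ∀ i, circle (q i) = circle ((activeCircles Q.1).equivFin.symm i).1.rep := fun i =>
      (hq i).trans (circle_rep _).symm
    have hr' : ∀ i, circle (q' i) =
        circle ((activeCircles Q'.1).equivFin.symm (e i)).1.rep := fun i =>
      (hq' i).trans (circle_rep _).symm
    congr 1
    · funext i
      rw [multBC_congr Q.2 (hr i), multBC_congr Q'.2 (hr' i), levelBC_congr (hr i),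
        levelBC_congr (hr' i)]
      exact (h1 i).symm
    · funext i j
      rw [fissionExp_congr (hr i) (hr j), fissionExp_congr (hr' i) (hr' j)]
      exact (h2 i j).symm

/-! ### Enhanced classes -/

theorem levelDIn_congr {p p' : ℕ} {m : Fin p → ℕ} {m' : Fin p' → ℕ} {q : Fin p → ExpFactor}
    {q' : Fin p' → ExpFactor} (e : Fin p ≃ Fin p') (hm : ∀ i, m' (e i) = m i) (h0 : ∀ i, 0 < m i)
    (hc : ∀ i, circle (q' (e i)) = circle (q i)) (i : Fin p) :
    levelDIn m' q' (e i) = levelDIn m q i := by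
  classical
  have hL := levelBC_congr (hc i)
  have hcond : (∀ j, j ≠ e i →
        max (slope (q' (e i))) (slope (q' j)) ≤ fissionExp (q' (e i)) (q' j)) ↔
      ∀ j, j ≠ i → max (slope (q i)) (slope (q j)) ≤ fissionExp (q i) (q j) := by
    rw [← e.forall_congr_right]
    refine forall_congr' fun j => ?_
    rw [e.injective.ne_iff, slope_congr (hc i), slope_congr (hc j), fissionExp_congr (hc i) (hc j)]
  rw [levelDIn_eq q (h0 i), levelDIn_eq q' (hm i ▸ h0 i)]
  simp only [hm, hcond, hL, sheets_congr hL, eq_zero_congr hL]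

theorem datumD_forget_eq {p p' : ℕ} {m : Fin p → ℕ} {m' : Fin p' → ℕ} {q : Fin p → ExpFactor}
    {q' : Fin p' → ExpFactor} {ε : Fin p → ℤˣ} {ε' : Fin p' → ℤˣ} (e : Fin p ≃ Fin p')
    (hm : ∀ i, m' (e i) = m i) (h0 : ∀ i, 0 < m i) (hc : ∀ i, circle (q' (e i)) = circle (q i))
    (hε : ∀ i, ε' (e i) = ε i) : (datumD m q ε).forget = (datumD m' q' ε').forget :=
  Quotient.sound ⟨e, fun i => Prod.ext (hm i) (Prod.ext (levelDIn_congr e hm h0 hc i) (hε i)),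
    fun i j => fissionExp_congr (hc i) (hc j)⟩

theorem EnhancedPointedType.forget_labelledDatum {P : EnhancedPointedType}
    {Θ : EnhancedClass} (h : P.classTerms = Θ.terms) :
    P.labelledDatum.forget = Θ.fissionDatum := by
  classical
  have hmem : ∀ i, (mkCircle (P.q i), P.mult i, P.sign i) ∈ Θ.terms := fun i => by
    rw [← h]
    exact Finset.mem_image_of_mem _ (Finset.mem_univ i)
  let f : Fin P.p → Θ.terms := fun i => ⟨_, hmem i⟩
  have hf : Function.Bijective f := by
    constructor
    · intro i j hij
      refine PointedType.eq_of_circle_eq ?_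
      rw [← mkCircle_eq_iff]
      exact congrArg (fun t : Θ.terms => t.1.1) hij
    · rintro ⟨t, ht⟩
      rw [← h] at ht
      obtain ⟨i, -, rfl⟩ := Finset.mem_image.1 ht
      exact ⟨i, rfl⟩
  let e : Fin P.p ≃ Fin Θ.terms.card := (Equiv.ofBijective f hf).trans Θ.terms.equivFin
  have he : ∀ i, Θ.terms.equivFin.symm (e i) = f i := fun i => by simp [e]
  have hc : ∀ i, circle (Θ.terms.equivFin.symm (e i)).1.1.rep = circle (P.q i) := fun i => by
    rw [he]
    exact circle_mkCircle_rep _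
  exact datumD_forget_eq e (fun i => congrArg (fun t : Θ.terms => t.1.2.1) (he i)) P.mult_pos hc
    fun i => congrArg (fun t : Θ.terms => t.1.2.2) (he i)

namespace EnhancedClass

/-- The enhanced pointed type given by an order of the terms of an enhanced class and points of the
circles. -/
def toPointed (Θ : EnhancedClass) {p : ℕ} (u : Fin p ≃ Θ.terms) (q : Fin p → ExpFactor)
    (hq : ∀ i, circle (q i) = (u i).1.1.1) : EnhancedPointedType where
  p := p
  p_pos := Fin.pos (u.symm ⟨_, Θ.nonempty.choose_spec⟩)
  mult i := (u i).1.2.1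
  mult_pos i := Θ.mult_pos _ (u i).2
  q := q
  distinct i j hij h := hij <| u.injective <| Subtype.ext <|
    Θ.distinct _ (u i).2 _ (u j).2 <| Subtype.ext <| by rw [← hq, ← hq, h]
  sign i := (u i).1.2.2
  sign_special i h := Θ.sign_special _ (u i).2 <|
    (isSpecial_congr (levelBC_congr ((hq i).trans (circle_rep _).symm))).1 h
  sign_nonspecial i h0 h := by
    have hL := levelBC_congr ((hq i).trans (circle_rep (u i).1.1).symm)
    exact Θ.sign_nonspecial _ (u i).2 (mt (eq_zero_congr hL).2 h0) (mt (isSpecial_congr hL).2 h)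

variable {Θ : EnhancedClass} {p : ℕ} {u : Fin p ≃ Θ.terms} {q : Fin p → ExpFactor}
  {hq : ∀ i, circle (q i) = (u i).1.1.1}

theorem classTerms_toPointed : (Θ.toPointed u q hq).classTerms = Θ.terms := by
  classical
  have h : ∀ i, (mkCircle (q i), (u i).1.2) = (u i).1 := fun i =>
    Prod.ext (Subtype.ext (hq i)) rfl
  ext t
  rw [EnhancedPointedType.classTerms, Finset.mem_image]
  constructor
  · rintro ⟨i, -, rfl⟩
    exact (h i).symm ▸ (u i).2
  · intro ht
    refine ⟨u.symm ⟨t, ht⟩, Finset.mem_univ _, (h _).trans ?_⟩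
    rw [Equiv.apply_symm_apply]

theorem isIrregularType_toPointed (h : Θ.IsPseudoIrregularClass) :
    (Θ.toPointed u q hq).IsIrregularType := by
  rw [IsPseudoIrregularClass, ← Finset.prod_coe_sort] at h
  exact (Equiv.prod_comp u fun t : Θ.terms => t.1.2.2).trans h

theorem admissible_iff (Θ Θ' : EnhancedClass) (hΘ : Θ.IsPseudoIrregularClass) :
    Θ.Admissible Θ' ↔ Θ.fissionDatum = Θ'.fissionDatum := by
  constructor
  · rintro ⟨P, P', hP, hP', h⟩
    rw [← EnhancedPointedType.forget_labelledDatum hP,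
      ← EnhancedPointedType.forget_labelledDatum hP', h.labelledDatum_eq]
  · intro h
    obtain ⟨e, h1, h2⟩ : ∃ e : Fin Θ.terms.card ≃ Fin Θ'.terms.card, _ := Quotient.exact h
    obtain ⟨q, hq, hc⟩ := exists_compatible_rep fun i => (Θ.terms.equivFin.symm i).1.1
    obtain ⟨q', hq', hc'⟩ := exists_compatible_rep fun i => (Θ'.terms.equivFin.symm (e i)).1.1
    refine ⟨Θ.toPointed Θ.terms.equivFin.symm q hq,
      Θ'.toPointed (e.trans Θ'.terms.equivFin.symm) q' hq', classTerms_toPointed,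
      classTerms_toPointed, ?_⟩
    refine (EnhancedPointedType.admissible_iff (isIrregularType_toPointed hΘ) (compatible_iff.2 hc)
      (compatible_iff.2 hc')).2 ?_
    have hr : ∀ i, circle (q i) = circle (Θ.terms.equivFin.symm i).1.1.rep := fun i =>
      (hq i).trans (circle_rep _).symm
    have hr' : ∀ i, circle (q' i) = circle (Θ'.terms.equivFin.symm (e i)).1.1.rep := fun i =>
      (hq' i).trans (circle_rep _).symm
    have hlab := fun i => Prod.ext_iff.1 (h1 i)
    have hlab2 := fun i => Prod.ext_iff.1 (hlab i).2
    refine congrArg₂ (LabelledDatum.mk Θ.terms.card) (funext fun i => ?_)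
      (funext fun i => funext fun j => ?_)
    · refine Prod.ext (hlab i).1.symm (Prod.ext ?_ (hlab2 i).2.symm)
      have e1 := levelDIn_congr (m := fun i => (Θ.terms.equivFin.symm i).1.2.1)
        (m' := fun i => (Θ.terms.equivFin.symm i).1.2.1) (Equiv.refl _) (fun _ => rfl)
        (fun i => Θ.mult_pos _ (Θ.terms.equivFin.symm i).2) hr i
      have e2 := levelDIn_congr (m := fun i => (Θ'.terms.equivFin.symm (e i)).1.2.1)
        (m' := fun i => (Θ'.terms.equivFin.symm i).1.2.1)
        (q' := fun i => (Θ'.terms.equivFin.symm i).1.1.rep) e (fun _ => rfl)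
        (fun i => Θ'.mult_pos _ (Θ'.terms.equivFin.symm (e i)).2) (fun i => (hr' i).symm) i
      exact e1.trans ((hlab2 i).1.symm.trans e2)
    · refine (fissionExp_congr (hr i) (hr j)).trans
        (Eq.trans ?_ (fissionExp_congr (hr' i) (hr' j)).symm)
      exact (h2 i j).symm

end EnhancedClass

end

end Fission

theorem mainTheorem10 :
    (∀ (m m' : ℕ), 1 ≤ m → 1 ≤ m' → ∀ (Θ : Fission.ClassBC m) (Θ' : Fission.ClassBC m'),
      Θ.Admissible Θ' ↔ Θ.fissionDatum = Θ'.fissionDatum) ∧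
    (∀ P P' : Fission.PointedType, P.Compatible → P'.Compatible →
      (Fission.AdmissibleBC P.full P'.full ↔ P.labelledDatumBC = P'.labelledDatumBC)) ∧
    (∀ Θ Θ' : Fission.EnhancedClass, Θ.IsPseudoIrregularClass → Θ'.IsPseudoIrregularClass →
      (Θ.Admissible Θ' ↔ Θ.fissionDatum = Θ'.fissionDatum)) ∧
    (∀ P P' : Fission.EnhancedPointedType, P.IsIrregularType → P'.IsIrregularType →
      P.Compatible → P'.Compatible →
      (P.Admissible P' ↔ P.labelledDatum = P'.labelledDatum)) :=
  ⟨fun _ _ hm _ Θ Θ' => Fission.ClassBC.admissible_iff hm Θ Θ',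
    fun _ _ hP hP' => Fission.PointedType.admissibleBC_iff hP hP',
    fun Θ Θ' hΘ _ => Fission.EnhancedClass.admissible_iff Θ Θ' hΘ,
    fun _ _ hI _ hP hP' => Fission.EnhancedPointedType.admissible_iff hI hP hP'⟩
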